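/- Let $H$ be a finite simple connected graph with $|V(H)|\ge 2$, and let $W:[0,1]^2\to[0,1]$ be a graphon, i.e. a measurable function with $W(x,y)=W(y,x)$. For a finite simple graph $F$ on $\{1,\dots,k\}$ put $$t(F,W)=\int_{[0,1]^k}\prod_{\{a,b\}\in E(F)}W(x_a,x_b)\,dx_1\cdots dx_k,$$ $$t_{\mathrm{ind}}(F,W)=\int_{[0,1]^k}\prod_{\{a,b\}\in E(F)}W(x_a,x_b)\prod_{a\ne b,\ \{a,b\}\notin E(F)}\bigl(1-W(x_a,x_b)\bigr)\,dx_1\cdots dx_k,$$ where the products run over unordered pairs, and for a finite simple graph $G$ put $t(F,G)=|\mathrm{hom}(F,G)|/|V(G)|^{|V(F)|}$, where $\mathrm{hom}(F,G)$ is the set of graph homomorphisms from $F$ to $G$. Let $(G_n)$ be a sequence of finite simple graphs converging to $W$, that is, $t(F,G_n)\to t(F,W)$ for every finite simple graph $F$, and assume $t(H,W)>0$. Colour the vertices of $G_n$ independently and uniformly at random with $c_n$ colours, let $X_v$ be the colour of the vertex $v$, and let $$T(H,G_n)=\frac1{|Aut(H)|}\sum_{s}\ \prod_{\{a,b\}\in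 E(H)}\mathbf 1\bigl\{\{s_a,s_b\}\in E(G_n)\bigr\}\ \mathbf 1\{X_{s_a}=X_{s_b}\text{ for all }a,b\in V(H)\}$$ be the number of monochromatic copies of $H$ in $G_n$, where $s=(s_a)_{a\in V(H)}$ runs over the tuples of distinct vertices of $G_n$ and $Aut(H)$ is the automorphism group of $H$. **Theorem.** Suppose that $c_n\to\infty$ and $\mathbb E\,T(H,G_n)\to\lambda$ for some real $\lambda$. Then $$T(H,G_n)\ \xrightarrow{\ d\ }\ \sum_{F\supseteq H,\ |V(F)|=|V(H)|}N(H,F)\,X_F .$$ Here the sum is over the isomorphism classes of graphs $F$ on $|V(H)|$ vertices that contain a copy of $H$, $N(H,F)$ is the number of subgraphs of $F$ isomorphic to $H$, and the $X_F$ are independent Poisson random variables with means $$\lambda\cdot\frac{|Aut(H)|}{|Aut(F)|}\cdot\frac{t_{\mathrm{ind}}(F,W)}{t(H,W)},$$ a Poisson variable of mean $0$ being identically $0$. -/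

import Mathlib

open MeasureTheory ProbabilityTheory Filter Topology

/-- A graphon: a measurable symmetric function `[0,1]² → [0,1]`. -/
structure Graphon where
  toFun : unitInterval → unitInterval → ℝ
  measurable' : Measurable (Function.uncurry toFun)
  symm' : ∀ x y, toFun x y = toFun y x
  mem_Icc' : ∀ x y, toFun x y ∈ Set.Icc (0 : ℝ) 1

noncomputable section

open scoped Classical

/-- The edges of a graph on `{0, …, k - 1}`, each one listed once, as the pair `(a, b)`
with `a < b`. -/
def edgePairs {k : ℕ} (F : SimpleGraph (Fin k)) : Finset (Fin k × Fin k) :=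
  Finset.univ.filter fun p => p.1 < p.2 ∧ F.Adj p.1 p.2

/-- The pairs of distinct non-adjacent vertices, each one listed once, with `a < b`. -/
def nonEdgePairs {k : ℕ} (F : SimpleGraph (Fin k)) : Finset (Fin k × Fin k) :=
  Finset.univ.filter fun p => p.1 < p.2 ∧ ¬ F.Adj p.1 p.2

/-- `|Aut(F)|`. -/
def autCard {k : ℕ} (F : SimpleGraph (Fin k)) : ℕ := Nat.card (F ≃g F)

/-- The homomorphism density `t(F, G) = |hom(F, G)| / |V(G)| ^ |V(F)|` in a finite graph. -/
def homDensity {k N : ℕ} (F : SimpleGraph (Fin k)) (G : SimpleGraph (Fin N)) : ℝ :=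
  (Nat.card (F →g G) : ℝ) / (N : ℝ) ^ k

/-- The homomorphism density `t(F, W)` in a graphon. -/
def Graphon.homDensity {k : ℕ} (F : SimpleGraph (Fin k)) (W : Graphon) : ℝ :=
  ∫ x : Fin k → unitInterval, ∏ p ∈ edgePairs F, W.toFun (x p.1) (x p.2)

/-- The induced homomorphism density `t_ind(F, W)` in a graphon. -/
def Graphon.indDensity {k : ℕ} (F : SimpleGraph (Fin k)) (W : Graphon) : ℝ :=
  ∫ x : Fin k → unitInterval,
    (∏ p ∈ edgePairs F, W.toFun (x p.1) (x p.2)) *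
      ∏ p ∈ nonEdgePairs F, (1 - W.toFun (x p.1) (x p.2))

/-- `G_n` converges to the graphon `W`: `t(F, G_n) → t(F, W)` for every finite simple graph `F`. -/
def ConvergesToGraphon {N : ℕ → ℕ} (G : (n : ℕ) → SimpleGraph (Fin (N n))) (W : Graphon) : Prop :=
  ∀ (k : ℕ) (F : SimpleGraph (Fin k)),
    Tendsto (fun n => homDensity F (G n)) atTop (𝓝 (W.homDensity F))

/-- `T(H, G)`, the number of monochromatic copies of `H` in `G`, for the vertex colouring `x`:
the sum over all tuples of distinct vertices of `G`, divided by `|Aut(H)|`. -/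
def monoCopies {k N c : ℕ} (H : SimpleGraph (Fin k)) (G : SimpleGraph (Fin N))
    (x : Fin N → Fin c) : ℝ :=
  (1 / (autCard H : ℝ)) * ∑ s : Fin k ↪ Fin N,
    (∏ p ∈ edgePairs H, G.adjMatrix ℝ (s p.1) (s p.2)) *
      (if ∀ a b, x (s a) = x (s b) then 1 else 0)

/-- The random variables `X v` are independent and uniform on the `c` colours. -/
structure IsUniformColoring {Ω : Type*} [MeasurableSpace Ω] (μ : Measure Ω) {N c : ℕ}
    (X : Fin N → Ω → Fin c) : Prop where
  measurable : ∀ v, Measurable (X v)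
  uniform : ∀ v a, μ (X v ⁻¹' {a}) = 1 / (c : ENNReal)
  indep : iIndepFun X μ

/-- `R` is a list of the unlabelled graphs `F ⊇ H` with `|V(F)| = |V(H)|`: it contains exactly one
representative of each isomorphism class of graphs on `|V(H)|` vertices that contain a copy
of `H`. -/
def IsSupergraphList {k : ℕ} (H : SimpleGraph (Fin k)) (R : Finset (SimpleGraph (Fin k))) : Prop :=
  (∀ F ∈ R, H.IsContained F) ∧
    ∀ F : SimpleGraph (Fin k), H.IsContained F → ∃! F', F' ∈ R ∧ Nonempty (F ≃g F')

theorem exists_isSupergraphList {k : ℕ} (H : SimpleGraph (Fin k)) :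
    ∃ R, IsSupergraphList H R := by
  let S : Setoid (SimpleGraph (Fin k)) :=
    { r := fun F F' => Nonempty (F ≃g F')
      iseqv := ⟨fun _ => ⟨SimpleGraph.Iso.refl⟩, fun ⟨e⟩ => ⟨e.symm⟩,
        fun ⟨e⟩ ⟨f⟩ => ⟨e.trans f⟩⟩ }
  refine ⟨Finset.univ.filter fun F => H.IsContained F ∧ (Quotient.mk S F).out = F, ?_, ?_⟩
  · intro F hF
    exact (Finset.mem_filter.1 hF).2.1
  · intro F hF
    have e : S.r (Quotient.mk S F).out F := Quotient.exact (Quotient.out_eq _)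
    obtain ⟨f⟩ := e
    refine ⟨(Quotient.mk S F).out, ⟨?_, ⟨f.symm⟩⟩, ?_⟩
    · refine Finset.mem_filter.2 ⟨Finset.mem_univ _, hF.trans ⟨f.symm.toCopy⟩, ?_⟩
      rw [Quotient.out_eq]
    · rintro F' ⟨h1, h2⟩
      have h3 := (Finset.mem_filter.1 h1).2.2
      have h4 : Quotient.mk S F = Quotient.mk S F' := Quotient.sound h2
      rw [h4, h3]

end

/-! Group the copies of $H$ by vertex set: $T=\sum_S w(S)\mathbf 1\{S\text{ mono}\}$ over the
$h$-subsets $S$ of $V(G_n)$, where $h=|V(H)|$ and $w(S)$ counts the copies of $H$ on $S$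
(`monoCopies_eq_monoWeight`). A given $S$ is monochromatic with probability $p=c^{-(h-1)}$, and sets
that do not meet $S$ are independent of this event. For $\lambda>0$ the convergence of the mean and
$t(H,W)>0$ give $N\to\infty$ and $N^h/c^{h-1}\to\kappa=\lambda|Aut(H)|/t(H,W)$, whence $N/c\to0$.
Pairs $S\ne S'$ that meet, with $|S'\setminus S|=d\ge1$, are jointly monochromatic with total
probability of order $N^{h+d}/c^{h+d-1}=(N^h/c^{h-1})(N/c)^d\to0$. The monochromatic sets thus
behave like a Poisson process, and $T$ is nearly compound Poisson.

This is made precise by a Stein-type argument on the characteristic function $\varphi$ of $T$. In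
$\varphi'(t)=\sum_S i\,w(S)\,\mathbb E[\mathbf 1_S e^{itT}]$ local dependence replaces each
expectation by $p\,e^{itw(S)}\varphi(t)$ (`norm_colorAvg_monoInd_mul_exp_sub_le`). So
$\varphi'\approx\Psi'\varphi$ with $\Psi(t)=\sum_S p\,(e^{itw(S)}-1)$, and integration gives
$\varphi\approx e^{\Psi}$ (`norm_monoChar_sub_exp_le`, `tendsto_monoChar_sub_exp`).

The weight $w(S)$ depends only on the graph $F$ induced on $S$ and equals $N(H,F)$. Convergence to
$W$ determines the frequency of each $F$, so $\Psi$ tends to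
$\sum_F\kappa\,\frac{t_{\mathrm{ind}}(F,W)}{|Aut(F)|}(e^{itN(H,F)}-1)$
(`ConvergesToGraphon.tendsto_poissonExponent`), the exponent of $\sum_F N(H,F)X_F$. Lévy's
continuity theorem concludes. For $\lambda=0$ the bound $|\varphi(t)-1|\le|t|\,\mathbb E T$
suffices. -/

noncomputable section

open scoped Classical

/-! ### Averages over uniform colourings -/

/-- The mean of `f` over all colourings of `V` with `c` colours. -/
def colorAvg {V : Type*} [Fintype V] {c : ℕ} {E : Type*} [AddCommGroup E] [Module ℝ E]
    (f : (V → Fin c) → E) : E :=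
  (((c : ℝ) ^ Fintype.card V)⁻¹) • ∑ x, f x

/-- The colouring `x` is constant on `S`. -/
def IsMono {V : Type*} {c : ℕ} (S : Finset V) (x : V → Fin c) : Prop :=
  ∀ a ∈ S, ∀ b ∈ S, x a = x b

/-- The indicator that `S` is monochromatic. -/
def monoInd {V : Type*} {c : ℕ} (S : Finset V) (x : V → Fin c) : ℝ :=
  if IsMono S x then 1 else 0

section Average

variable {V : Type*} {c : ℕ}

lemma monoInd_nonneg (S : Finset V) (x : V → Fin c) : 0 ≤ monoInd S x := by
  unfold monoInd; split_ifs <;> norm_num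

lemma monoInd_eq_zero_or_one (S : Finset V) (x : V → Fin c) :
    monoInd S x = 0 ∨ monoInd S x = 1 := by
  unfold monoInd; split_ifs <;> simp

/-- A common vertex forces the two sets to have the same colour, so a joint probability becomes that
of a single larger set. -/
lemma monoInd_mul_of_not_disjoint {S S' : Finset V} (hS : ¬ Disjoint S' S) (x : V → Fin c) :
    monoInd S x * monoInd S' x = monoInd (S ∪ S') x := by
  obtain ⟨v, hv', hv⟩ := Finset.not_disjoint_iff.1 hS
  have key : IsMono (S ∪ S') x ↔ IsMono S x ∧ IsMono S' x := by
    constructor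
    · intro h
      exact ⟨fun a ha b hb => h a (Finset.mem_union_left _ ha) b (Finset.mem_union_left _ hb),
        fun a ha b hb => h a (Finset.mem_union_right _ ha) b (Finset.mem_union_right _ hb)⟩
    · rintro ⟨h1, h2⟩
      have : ∀ a ∈ S ∪ S', x a = x v := by
        intro a ha
        rcases Finset.mem_union.1 ha with ha | ha
        · exact h1 a ha v hv
        · exact h2 a ha v hv'
      intro a ha b hb
      rw [this a ha, this b hb]
  unfold monoInd
  by_cases h1 : IsMono S x <;> by_cases h2 : IsMono S' x <;> simp [key, h1, h2]

variable [Fintype V]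

section Module

variable {E : Type*}

lemma colorAvg_sub [AddCommGroup E] [Module ℝ E] (f g : (V → Fin c) → E) :
    colorAvg (fun x => f x - g x) = colorAvg f - colorAvg g := by
  simp [colorAvg, Finset.sum_sub_distrib, smul_sub]

lemma colorAvg_sum [AddCommGroup E] [Module ℝ E] {ι : Type*} (s : Finset ι)
    (f : ι → (V → Fin c) → E) :
    colorAvg (fun x => ∑ i ∈ s, f i x) = ∑ i ∈ s, colorAvg (f i) := by
  simp only [colorAvg]
  rw [Finset.sum_comm, Finset.smul_sum]

lemma colorAvg_const_mul {𝕜 : Type*} [RCLike 𝕜] (a : 𝕜) (f : (V → Fin c) → 𝕜) :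
    colorAvg (fun x => a * f x) = a * colorAvg f := by
  simp only [colorAvg]
  rw [← Finset.mul_sum, mul_smul_comm]

lemma norm_colorAvg_le [NormedAddCommGroup E] [NormedSpace ℝ E] {f : (V → Fin c) → E}
    {g : (V → Fin c) → ℝ} (h : ∀ x, ‖f x‖ ≤ g x) : ‖colorAvg f‖ ≤ colorAvg g := by
  simp only [colorAvg, smul_eq_mul, norm_smul]
  rw [Real.norm_of_nonneg (by positivity)]
  exact mul_le_mul_of_nonneg_left (norm_sum_le_of_le _ fun x _ => h x) (by positivity)

lemma colorAvg_const [AddCommGroup E] [Module ℝ E] (hc : 0 < c) (a : E) :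
    colorAvg (fun _ : V → Fin c => a) = a := by
  have : ((c : ℝ) ^ Fintype.card V) ≠ 0 := by positivity
  simp only [colorAvg, Finset.sum_const, Finset.card_univ, Fintype.card_fun, Fintype.card_fin]
  rw [← Nat.cast_smul_eq_nsmul ℝ, smul_smul]
  push_cast
  rw [inv_mul_cancel₀ this, one_smul]

end Module

lemma card_filter_const {ι : Type*} [Fintype ι] [DecidableEq ι] [Nonempty ι] (c : ℕ)
    [DecidablePred fun u : ι → Fin c => ∀ a b, u a = u b] :
    (Finset.univ.filter fun u : ι → Fin c => ∀ a b, u a = u b).card = c := by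
  have : (Finset.univ.filter fun u : ι → Fin c => ∀ a b, u a = u b)
      = Finset.univ.image (Function.const ι) := by
    ext u
    simp only [Finset.mem_filter, Finset.mem_univ, true_and, Finset.mem_image]
    constructor
    · intro h
      exact ⟨u (Classical.arbitrary ι), funext fun a => h _ a⟩
    · rintro ⟨a, rfl⟩ _ _
      rfl
  rw [this, Finset.card_image_of_injective _ Function.const_injective]
  simp

/-- A function of the colours outside `S` is independent of the event that `S` is
monochromatic. -/
lemma pow_mul_sum_monoInd_mul {S : Finset V} (hS : S.Nonempty) {g : (V → Fin c) → ℂ}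
    (hg : ∀ x y : V → Fin c, (∀ v, v ∉ S → x v = y v) → g x = g y) :
    (c : ℂ) ^ S.card * ∑ x, (monoInd S x : ℂ) * g x = c * ∑ x, g x := by
  have : Nonempty {v // v ∈ S} := hS.to_subtype
  let e := Equiv.piEquivPiSubtypeProd (fun v => v ∈ S) (fun _ => Fin c)
  have hg' : ∀ u u' v, g (e.symm (u, v)) = g (e.symm (u', v)) := by
    intro u u' v
    refine hg _ _ fun w hw => ?_
    simp [e, Equiv.piEquivPiSubtypeProd, hw]
  have hm : ∀ u v, monoInd S (e.symm (u, v)) = if ∀ a b, u a = u b then 1 else 0 := by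
    intro u v
    have : IsMono S (e.symm (u, v)) ↔ ∀ a b, u a = u b := by
      constructor
      · intro h a b
        have := h a.1 a.2 b.1 b.2
        simpa [e, Equiv.piEquivPiSubtypeProd] using this
      · intro h a ha b hb
        simpa [e, Equiv.piEquivPiSubtypeProd, ha, hb] using h ⟨a, ha⟩ ⟨b, hb⟩
    unfold monoInd
    simp only [this]
  by_cases hc : c = 0
  · subst hc
    have : IsEmpty (V → Fin 0) := ⟨fun x => (x hS.choose).elim0⟩
    simp
  have : Nonempty (Fin c) := ⟨⟨0, Nat.pos_of_ne_zero hc⟩⟩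
  -- A colouring is a pair (colours on `S`, colours off `S`). Since `g` ignores the first component,
  -- every fibre sum equals the one over the reference value `u₀`, and only the `c` constant
  -- colourings of `S` have nonzero indicator.
  let u₀ : {v // v ∈ S} → Fin c := fun _ => Classical.arbitrary _
  rw [← e.symm.sum_comp, ← e.symm.sum_comp, Fintype.sum_prod_type, Fintype.sum_prod_type]
  have h1 : ∀ u, ∑ v, g (e.symm (u, v)) = ∑ v, g (e.symm (u₀, v)) := fun u =>
    Finset.sum_congr rfl fun v _ => hg' u u₀ v
  have h2 : ∀ u, ∑ v, (monoInd S (e.symm (u, v)) : ℂ) * g (e.symm (u, v))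
      = (if ∀ a b, u a = u b then 1 else 0) * ∑ v, g (e.symm (u₀, v)) := by
    intro u
    rw [← h1 u, Finset.mul_sum]
    refine Finset.sum_congr rfl fun v _ => ?_
    rw [hm]
    split_ifs <;> simp
  simp only [h1, h2]
  rw [← Finset.sum_mul, Finset.sum_boole, card_filter_const]
  simp only [Finset.sum_const, Finset.card_univ, Fintype.card_fun, Fintype.card_fin,
    Fintype.card_coe, nsmul_eq_mul]
  push_cast
  ring

/-- Exactly `c` of the `c ^ S.card` colourings of `S` are constant, hence the exponent `S.card - 1`;
the subtraction is genuine because `S` is nonempty. -/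
lemma colorAvg_monoInd_mul (hc : 0 < c) {S : Finset V} (hS : S.Nonempty)
    {g : (V → Fin c) → ℂ} (hg : ∀ x y : V → Fin c, (∀ v, v ∉ S → x v = y v) → g x = g y) :
    colorAvg (fun x => (monoInd S x : ℂ) * g x)
      = (((c : ℝ) ^ (S.card - 1))⁻¹ : ℝ) * colorAvg g := by
  have h := pow_mul_sum_monoInd_mul hS hg
  obtain ⟨m, hm⟩ : ∃ m, S.card = m + 1 := ⟨S.card - 1, by have := hS.card_pos; omega⟩
  have hc' : (c : ℂ) ≠ 0 := by exact_mod_cast hc.ne'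
  rw [hm, pow_succ', mul_assoc] at h
  have h' := mul_left_cancel₀ hc' h
  simp only [colorAvg]
  rw [mul_smul_comm, ← h', hm]
  congr 1
  push_cast
  rw [← mul_assoc, inv_mul_cancel₀ (pow_ne_zero _ hc'), one_mul]

lemma colorAvg_monoInd (hc : 0 < c) {S : Finset V} (hS : S.Nonempty) :
    colorAvg (fun x : V → Fin c => monoInd S x) = ((c : ℝ) ^ (S.card - 1))⁻¹ := by
  have h := colorAvg_monoInd_mul (V := V) hc hS (g := fun _ => 1) (fun _ _ _ => rfl)
  rw [colorAvg_const hc] at h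
  simp only [mul_one] at h
  have h2 : colorAvg (fun x : V → Fin c => (monoInd S x : ℂ))
      = ((colorAvg (fun x : V → Fin c => monoInd S x) : ℝ) : ℂ) := by
    simp [colorAvg]
  rw [h2] at h
  exact_mod_cast h

end Average

/-- The expectation of a function of a uniform colouring is its mean over all colourings. -/
lemma IsUniformColoring.integral_eq {Ω : Type*} [MeasurableSpace Ω] {μ : Measure Ω}
    [IsProbabilityMeasure μ] {N c : ℕ} {X : Fin N → Ω → Fin c} (hX : IsUniformColoring μ X)
    {E : Type*} [NormedAddCommGroup E] [NormedSpace ℝ E] [CompleteSpace E]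
    (f : (Fin N → Fin c) → E) :
    ∫ ω, f (fun v => X v ω) ∂μ = colorAvg f := by
  have hm : Measurable fun ω v => X v ω := measurable_pi_lambda _ hX.measurable
  have hf : StronglyMeasurable f := .of_discrete
  have : IsProbabilityMeasure (μ.map fun ω v => X v ω) :=
    Measure.isProbabilityMeasure_map hm.aemeasurable
  rw [← integral_map (φ := fun ω v => X v ω) hm.aemeasurable hf.aestronglyMeasurable,
    integral_fintype (Integrable.of_finite), colorAvg, Finset.smul_sum]
  refine Finset.sum_congr (by ext; simp) fun x _ => ?_
  congr 1
  rw [measureReal_def, Measure.map_apply hm (measurableSet_singleton _)]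
  have : (fun ω v => X v ω) ⁻¹' {x} = ⋂ v ∈ (Finset.univ : Finset (Fin N)), X v ⁻¹' {x v} := by
    ext ω
    simp [funext_iff]
  rw [this, hX.indep.measure_inter_preimage_eq_mul _ (fun v _ => measurableSet_singleton _)]
  simp [hX.uniform]

/-! ### The characteristic function of a weighted number of monochromatic sets -/

/-- The total weight of the monochromatic `k`-subsets of `V`. -/
def monoWeight {V : Type*} [Fintype V] {c : ℕ} (k : ℕ) (w : Finset V → ℝ) (x : V → Fin c) : ℝ :=
  ∑ S ∈ Finset.powersetCard k Finset.univ, w S * monoInd S x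

/-- The total weight of the monochromatic `k`-subsets of `V` that are disjoint from `S`. -/
def monoWeightOff {V : Type*} [Fintype V] {c : ℕ} (k : ℕ) (w : Finset V → ℝ) (S : Finset V)
    (x : V → Fin c) : ℝ :=
  ∑ S' ∈ Finset.powersetCard k Finset.univ with Disjoint S' S, w S' * monoInd S' x

/-- The `k`-subsets of `V` that meet `S`. -/
def meeting {V : Type*} [Fintype V] (k : ℕ) (S : Finset V) : Finset (Finset V) :=
  (Finset.powersetCard k Finset.univ).filter fun S' => ¬ Disjoint S' S

/-- The characteristic function of `monoWeight` for a uniform colouring with `c` colours. -/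
def monoChar {V : Type*} [Fintype V] (c k : ℕ) (w : Finset V → ℝ) (t : ℝ) : ℂ :=
  colorAvg fun x : V → Fin c => Complex.exp ((t * monoWeight k w x : ℝ) * Complex.I)

/-- The sum of `P(S mono) P(S' mono)` over the pairs of `k`-sets that meet. -/
def overlapProd (V : Type*) [Fintype V] (c k : ℕ) : ℝ :=
  ∑ S ∈ Finset.powersetCard k (Finset.univ : Finset V), ∑ _S' ∈ meeting k S,
    ((c : ℝ) ^ (k - 1))⁻¹ * ((c : ℝ) ^ (k - 1))⁻¹

/-- The sum of `P(S and S' mono)` over the pairs of distinct `k`-sets that meet. -/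
def overlapJoint (V : Type*) [Fintype V] (c k : ℕ) : ℝ :=
  ∑ S ∈ Finset.powersetCard k (Finset.univ : Finset V), ∑ S' ∈ (meeting k S).erase S,
    ((c : ℝ) ^ ((S ∪ S').card - 1))⁻¹

section

variable {V : Type*} [Fintype V] {c k : ℕ} {w : Finset V → ℝ}

lemma norm_exp_mul_I_sub_le (a b : ℝ) :
    ‖Complex.exp (a * Complex.I) - Complex.exp (b * Complex.I)‖ ≤ 2 := by
  refine (norm_sub_le _ _).trans ?_
  rw [Complex.norm_exp_ofReal_mul_I, Complex.norm_exp_ofReal_mul_I]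
  norm_num

lemma monoWeight_eq_add (S : Finset V) (x : V → Fin c) :
    monoWeight k w x = monoWeightOff k w S x + ∑ S' ∈ meeting k S, w S' * monoInd S' x :=
  (Finset.sum_filter_add_sum_filter_not _ _ _).symm

lemma mem_meeting_self (hk : 0 < k) {S : Finset V} (hS : S.card = k) : S ∈ meeting k S := by
  simp only [meeting, Finset.mem_filter, Finset.mem_powersetCard_univ, hS, true_and, disjoint_self,
    Finset.bot_eq_empty]
  rintro rfl
  simp at hS
  omega

/-- When `S` is monochromatic, the two exponents differ only if another set meeting `S` is
monochromatic too. Two unit complex numbers are at distance at most 2, and a union bound over those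
sets finishes. -/
lemma norm_monoInd_mul_exp_sub_le (hk : 0 < k) {S : Finset V} (hS : S.card = k) (t : ℝ)
    (x : V → Fin c) :
    ‖(monoInd S x : ℂ) * (Complex.exp ((t * monoWeight k w x : ℝ) * Complex.I)
        - Complex.exp ((t * (w S + monoWeightOff k w S x) : ℝ) * Complex.I))‖
      ≤ 2 * ∑ S' ∈ (meeting k S).erase S, monoInd S x * monoInd S' x := by
  have h0 : ∀ S' ∈ (meeting k S).erase S, 0 ≤ monoInd S x * monoInd S' x := fun S' _ =>
    mul_nonneg (monoInd_nonneg _ _) (monoInd_nonneg _ _)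
  rcases monoInd_eq_zero_or_one S x with h | h
  · rw [h]
    simp
  rw [h]
  by_cases hex : ∃ S' ∈ (meeting k S).erase S, monoInd S' x = 1
  · obtain ⟨S', hS', h'⟩ := hex
    rw [Complex.ofReal_one, one_mul]
    refine (norm_exp_mul_I_sub_le _ _).trans ?_
    have := Finset.single_le_sum h0 hS'
    rw [h, h'] at this
    linarith
  · push Not at hex
    have hz : ∀ S' ∈ (meeting k S).erase S, monoInd S' x = 0 := fun S' hS' =>
      (monoInd_eq_zero_or_one S' x).resolve_right (hex S' hS')
    have : monoWeight k w x = w S + monoWeightOff k w S x := by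
      rw [monoWeight_eq_add S, ← Finset.add_sum_erase _ _ (mem_meeting_self hk hS), h,
        Finset.sum_eq_zero fun S' hS' => by rw [hz S' hS', mul_zero]]
      ring
    rw [this, sub_self, mul_zero, norm_zero]
    rw [h] at h0
    linarith [Finset.sum_nonneg h0]

lemma norm_exp_monoWeightOff_sub_le (S : Finset V) (t : ℝ) (x : V → Fin c) :
    ‖Complex.exp ((t * monoWeightOff k w S x : ℝ) * Complex.I)
        - Complex.exp ((t * monoWeight k w x : ℝ) * Complex.I)‖
      ≤ 2 * ∑ S' ∈ meeting k S, monoInd S' x := by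
  have h0 : ∀ S' ∈ meeting k S, 0 ≤ monoInd S' x := fun S' _ => monoInd_nonneg _ _
  by_cases hex : ∃ S' ∈ meeting k S, monoInd S' x = 1
  · obtain ⟨S', hS', h'⟩ := hex
    refine (norm_exp_mul_I_sub_le _ _).trans ?_
    have := Finset.single_le_sum h0 hS'
    rw [h'] at this
    linarith
  · push Not at hex
    have hz : ∀ S' ∈ meeting k S, monoInd S' x = 0 := fun S' hS' =>
      (monoInd_eq_zero_or_one S' x).resolve_right (hex S' hS')
    have : monoWeight k w x = monoWeightOff k w S x := by
      rw [monoWeight_eq_add S, Finset.sum_eq_zero fun S' hS' => by rw [hz S' hS', mul_zero],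
        add_zero]
    rw [this, sub_self, norm_zero]
    linarith [Finset.sum_nonneg h0]

/-- This is the hypothesis needed to treat `monoWeightOff` as independent of the event that `S` is
monochromatic. -/
lemma monoWeightOff_congr (S : Finset V) {x y : V → Fin c} (h : ∀ v, v ∉ S → x v = y v) :
    monoWeightOff k w S x = monoWeightOff k w S y := by
  refine Finset.sum_congr rfl fun S' hS' => ?_
  have hd := (Finset.mem_filter.1 hS').2
  have h' : ∀ a ∈ S', x a = y a := fun a ha => h a (Finset.disjoint_left.1 hd ha)
  have : IsMono S' x ↔ IsMono S' y := by
    constructor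
    · intro hm a ha b hb
      rw [← h' a ha, ← h' b hb, hm a ha b hb]
    · intro hm a ha b hb
      rw [h' a ha, h' b hb, hm a ha b hb]
  simp only [monoInd, this]

lemma card_of_mem_meeting {S S' : Finset V} (h : S' ∈ meeting k S) : S'.card = k :=
  Finset.mem_powersetCard_univ.1 (Finset.mem_filter.1 h).1

/-- The local dependence step. On the event that `S` is monochromatic, the total is replaced by `w
S` plus the part off `S`, at the cost of the joint probabilities. Independence then factors the
average, and restoring the full total costs the products of probabilities. -/
lemma norm_colorAvg_monoInd_mul_exp_sub_le (hc : 0 < c) (hk : 0 < k) {S : Finset V}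
    (hS : S.card = k) (t : ℝ) :
    ‖colorAvg (fun x : V → Fin c =>
          (monoInd S x : ℂ) * Complex.exp ((t * monoWeight k w x : ℝ) * Complex.I))
        - (((c : ℝ) ^ (k - 1))⁻¹ : ℝ) * Complex.exp ((t * w S : ℝ) * Complex.I)
          * monoChar c k w t‖
      ≤ 2 * ∑ S' ∈ (meeting k S).erase S, ((c : ℝ) ^ ((S ∪ S').card - 1))⁻¹
        + 2 * ∑ _S' ∈ meeting k S, ((c : ℝ) ^ (k - 1))⁻¹ * ((c : ℝ) ^ (k - 1))⁻¹ := by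
  have hSne : S.Nonempty := Finset.card_pos.1 (hS ▸ hk)
  set p : ℝ := ((c : ℝ) ^ (k - 1))⁻¹ with hp
  have hp0 : 0 ≤ p := by positivity
  set E : (V → Fin c) → ℂ := fun x => Complex.exp ((t * monoWeight k w x : ℝ) * Complex.I)
  set E' : (V → Fin c) → ℂ := fun x => Complex.exp ((t * monoWeightOff k w S x : ℝ) * Complex.I)
  have hind : colorAvg (fun x : V → Fin c => (monoInd S x : ℂ) *
      Complex.exp ((t * (w S + monoWeightOff k w S x) : ℝ) * Complex.I))
      = p * Complex.exp ((t * w S : ℝ) * Complex.I) * colorAvg E' := by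
    have h1 := colorAvg_monoInd_mul (c := c) hc hSne (g := E') fun x y hxy => by
      simp only [E', monoWeightOff_congr S hxy]
    rw [hS] at h1
    have h2 : (fun x : V → Fin c => (monoInd S x : ℂ) *
        Complex.exp ((t * (w S + monoWeightOff k w S x) : ℝ) * Complex.I))
        = fun x => Complex.exp ((t * w S : ℝ) * Complex.I) * ((monoInd S x : ℂ) * E' x) := by
      funext x
      simp only [E']
      rw [mul_left_comm, ← Complex.exp_add]
      congr 2
      push_cast
      ring
    rw [h2, colorAvg_const_mul, h1]
    ring
  have e1 : colorAvg (fun x : V → Fin c => (monoInd S x : ℂ) * E x)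
      - p * Complex.exp ((t * w S : ℝ) * Complex.I) * monoChar c k w t
      = colorAvg (fun x : V → Fin c => (monoInd S x : ℂ) * (E x
          - Complex.exp ((t * (w S + monoWeightOff k w S x) : ℝ) * Complex.I)))
        + p * Complex.exp ((t * w S : ℝ) * Complex.I) * colorAvg (fun x => E' x - E x) := by
    simp only [mul_sub]
    rw [colorAvg_sub, colorAvg_sub, hind]
    simp only [monoChar, E]
    ring
  rw [e1]
  refine (norm_add_le _ _).trans (add_le_add ?_ ?_)
  · refine (norm_colorAvg_le fun x => norm_monoInd_mul_exp_sub_le hk hS t x).trans ?_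
    rw [colorAvg_const_mul, colorAvg_sum]
    refine le_of_eq ?_
    congr 1
    refine Finset.sum_congr rfl fun S' hS' => ?_
    have hm := (Finset.mem_erase.1 hS').2
    have : (fun x : V → Fin c => monoInd S x * monoInd S' x) = fun x => monoInd (S ∪ S') x :=
      funext fun x => monoInd_mul_of_not_disjoint (Finset.mem_filter.1 hm).2 x
    rw [this, colorAvg_monoInd hc (hSne.mono Finset.subset_union_left)]
  · rw [norm_mul, norm_mul, Complex.norm_exp_ofReal_mul_I, mul_one, Complex.norm_real,
      Real.norm_of_nonneg hp0, ← Finset.mul_sum, mul_left_comm]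
    refine mul_le_mul_of_nonneg_left ?_ hp0
    refine (norm_colorAvg_le fun x => norm_exp_monoWeightOff_sub_le S t x).trans ?_
    rw [colorAvg_const_mul, colorAvg_sum]
    refine le_of_eq ?_
    congr 1
    refine Finset.sum_congr rfl fun S' hS' => ?_
    have hS'k := card_of_mem_meeting hS'
    rw [colorAvg_monoInd hc (Finset.card_pos.1 (hS'k ▸ hk)), hS'k]

/-- The exponent of the characteristic function of the Poisson approximation. -/
def poissonExponent {V : Type*} [Fintype V] (c k : ℕ) (w : Finset V → ℝ) (t : ℝ) : ℂ :=
  ∑ S ∈ Finset.powersetCard k (Finset.univ : Finset V),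
    (((c : ℝ) ^ (k - 1))⁻¹ : ℝ) * (Complex.exp ((t * w S : ℝ) * Complex.I) - 1)

lemma hasDerivAt_exp_mul_I (a t : ℝ) :
    HasDerivAt (fun t : ℝ => Complex.exp ((t * a : ℝ) * Complex.I))
      (a * Complex.I * Complex.exp ((t * a : ℝ) * Complex.I)) t := by
  have h1 : HasDerivAt (fun t : ℝ => ((t * a : ℝ) : ℂ) * Complex.I) ((a : ℂ) * Complex.I) t := by
    have h2 : HasDerivAt (fun t : ℝ => t * a) a t := by
      simpa using (hasDerivAt_id t).mul_const a
    exact h2.ofReal_comp.mul_const _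
  simpa [mul_comm] using h1.cexp

/-- Differentiation brings down the factor `monoWeight`; expanding it over `S` yields the averages
estimated above. -/
lemma hasDerivAt_monoChar (t : ℝ) :
    HasDerivAt (monoChar (V := V) c k w)
      (∑ S ∈ Finset.powersetCard k Finset.univ, w S * Complex.I * colorAvg (fun x : V → Fin c =>
          (monoInd S x : ℂ) * Complex.exp ((t * monoWeight k w x : ℝ) * Complex.I))) t := by
  have h1 : HasDerivAt (fun t : ℝ => ∑ x : V → Fin c,
      Complex.exp ((t * monoWeight k w x : ℝ) * Complex.I))
      (∑ x : V → Fin c, (monoWeight k w x : ℂ) * Complex.I *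
        Complex.exp ((t * monoWeight k w x : ℝ) * Complex.I)) t :=
    HasDerivAt.fun_sum fun x _ => hasDerivAt_exp_mul_I _ t
  have h2 := h1.const_smul (((c : ℝ) ^ Fintype.card V)⁻¹)
  convert! h2 using 1
  change _ = colorAvg fun x : V → Fin c => (monoWeight k w x : ℂ) * Complex.I *
        Complex.exp ((t * monoWeight k w x : ℝ) * Complex.I)
  simp only [← colorAvg_const_mul]
  rw [← colorAvg_sum]
  congr 1
  funext x
  simp only [monoWeight]
  push_cast
  rw [Finset.sum_mul, Finset.sum_mul]
  refine Finset.sum_congr rfl fun S _ => ?_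
  ring

lemma hasDerivAt_poissonExponent (t : ℝ) :
    HasDerivAt (poissonExponent (V := V) c k w)
      (∑ S ∈ Finset.powersetCard k (Finset.univ : Finset V), (((c : ℝ) ^ (k - 1))⁻¹ : ℝ) *
        (w S * Complex.I * Complex.exp ((t * w S : ℝ) * Complex.I))) t :=
  HasDerivAt.fun_sum fun _ _ => ((hasDerivAt_exp_mul_I _ t).sub_const 1).const_mul _

/-- The characteristic function almost solves the linear equation $\varphi'=\Psi'\varphi$ that
$e^\Psi$ solves exactly; the overlaps control the error uniformly in `t`. -/
lemma norm_deriv_monoChar_sub_le (hc : 0 < c) (hk : 0 < k) {M : ℝ}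
    (hM : ∀ S : Finset V, S.card = k → |w S| ≤ M) (t : ℝ) :
    ‖(∑ S ∈ Finset.powersetCard k Finset.univ, w S * Complex.I * colorAvg (fun x : V → Fin c =>
          (monoInd S x : ℂ) * Complex.exp ((t * monoWeight k w x : ℝ) * Complex.I)))
      - (∑ S ∈ Finset.powersetCard k (Finset.univ : Finset V), (((c : ℝ) ^ (k - 1))⁻¹ : ℝ) *
        (w S * Complex.I * Complex.exp ((t * w S : ℝ) * Complex.I))) * monoChar c k w t‖
      ≤ M * (2 * overlapJoint V c k + 2 * overlapProd V c k) := by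
  rw [Finset.sum_mul, ← Finset.sum_sub_distrib]
  simp only [overlapJoint, overlapProd]
  rw [Finset.mul_sum, Finset.mul_sum, ← Finset.sum_add_distrib, Finset.mul_sum]
  refine norm_sum_le_of_le _ fun S hS => ?_
  have hS := Finset.mem_powersetCard_univ.1 hS
  have h1 := norm_colorAvg_monoInd_mul_exp_sub_le (w := w) hc hk hS t
  refine le_trans (le_of_eq ?_)
    (mul_le_mul (hM S hS) h1 (norm_nonneg _) ((abs_nonneg _).trans (hM S hS)))
  rw [← Real.norm_eq_abs, ← Complex.norm_real, ← mul_one ‖(w S : ℂ)‖, ← Complex.norm_I,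
    ← norm_mul, ← norm_mul]
  congr 1
  ring

lemma re_poissonExponent_nonpos (t : ℝ) : (poissonExponent (V := V) c k w t).re ≤ 0 := by
  simp only [poissonExponent]
  rw [Complex.re_sum]
  refine Finset.sum_nonpos fun S _ => ?_
  rw [Complex.re_ofReal_mul, Complex.sub_re, Complex.exp_ofReal_mul_I_re, Complex.one_re]
  exact mul_nonpos_of_nonneg_of_nonpos (by positivity) (by linarith [Real.cos_le_one (t * w S)])

/-- From $\cos\ge-1$ and $\binom Nk\le N^k$. It bounds the integrating factor $e^{-\Psi}$ uniformly
in `t`. -/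
lemma neg_le_re_poissonExponent (t : ℝ) :
    -(2 * ((Fintype.card V : ℝ) ^ k / (c : ℝ) ^ (k - 1))) ≤
      (poissonExponent (V := V) c k w t).re := by
  simp only [poissonExponent]
  rw [Complex.re_sum]
  have h1 : ∀ S ∈ Finset.powersetCard k (Finset.univ : Finset V),
      ((c : ℝ) ^ (k - 1))⁻¹ * (-2) ≤ ((((c : ℝ) ^ (k - 1))⁻¹ : ℝ) *
        (Complex.exp ((t * w S : ℝ) * Complex.I) - 1) : ℂ).re := by
    intro S _
    rw [Complex.re_ofReal_mul, Complex.sub_re, Complex.exp_ofReal_mul_I_re, Complex.one_re]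
    exact mul_le_mul_of_nonneg_left (by linarith [Real.neg_one_le_cos (t * w S)]) (by positivity)
  refine le_trans ?_ (Finset.sum_le_sum h1)
  rw [Finset.sum_const, Finset.card_powersetCard, Finset.card_univ, nsmul_eq_mul]
  have h2 : ((Fintype.card V).choose k : ℝ) ≤ (Fintype.card V : ℝ) ^ k := by
    exact_mod_cast Nat.choose_le_pow _ _
  have h3 : (0 : ℝ) ≤ ((c : ℝ) ^ (k - 1))⁻¹ := by positivity
  rw [div_eq_mul_inv]
  nlinarith [mul_le_mul_of_nonneg_right h2 h3]

/-- The compound Poisson approximation of the weighted number of monochromatic sets. -/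
theorem norm_monoChar_sub_exp_le (hc : 0 < c) (hk : 0 < k) {M : ℝ}
    (hM : ∀ S : Finset V, S.card = k → |w S| ≤ M) (t : ℝ) :
    ‖monoChar (V := V) c k w t - Complex.exp (poissonExponent (V := V) c k w t)‖ ≤
      M * (2 * overlapJoint V c k + 2 * overlapProd V c k)
        * Real.exp (2 * ((Fintype.card V : ℝ) ^ k / (c : ℝ) ^ (k - 1))) * |t| := by
  set ε := M * (2 * overlapJoint V c k + 2 * overlapProd V c k) with hε
  set A := Real.exp (2 * ((Fintype.card V : ℝ) ^ k / (c : ℝ) ^ (k - 1)))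
  let φ : ℝ → ℂ := monoChar (V := V) c k w
  let Ψ : ℝ → ℂ := poissonExponent (V := V) c k w
  let φ' : ℝ → ℂ := fun t => ∑ S ∈ Finset.powersetCard k Finset.univ, w S * Complex.I *
    colorAvg (fun x : V → Fin c =>
          (monoInd S x : ℂ) * Complex.exp ((t * monoWeight k w x : ℝ) * Complex.I))
  let Ψ' : ℝ → ℂ := fun t =>
    ∑ S ∈ Finset.powersetCard k (Finset.univ : Finset V), (((c : ℝ) ^ (k - 1))⁻¹ : ℝ) *
        (w S * Complex.I * Complex.exp ((t * w S : ℝ) * Complex.I))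
  have hφ : ∀ s, HasDerivAt φ (φ' s) s := fun s => hasDerivAt_monoChar s
  have hΨ : ∀ s, HasDerivAt Ψ (Ψ' s) s := fun s => hasDerivAt_poissonExponent s
  -- Integrating factor: the product equals 1 at 0 and its derivative is small, so the mean value
  -- inequality keeps it near 1 up to time `t`.
  have hd : ∀ s, HasDerivAt (fun s => φ s * Complex.exp (-Ψ s))
      ((φ' s - Ψ' s * φ s) * Complex.exp (-Ψ s)) s := by
    intro s
    convert! (hφ s).mul (hΨ s).fun_neg.cexp using 1
    ring
  have hb : ∀ s, ‖(φ' s - Ψ' s * φ s) * Complex.exp (-Ψ s)‖ ≤ ε * A := by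
    intro s
    have h1 := norm_deriv_monoChar_sub_le (w := w) hc hk hM s
    rw [norm_mul]
    refine mul_le_mul h1 ?_ (norm_nonneg _) ((norm_nonneg _).trans h1)
    rw [Complex.norm_exp, Complex.neg_re]
    exact Real.exp_le_exp.2 (neg_le.1 (neg_le_re_poissonExponent (w := w) s))
  have hφ0 : φ 0 = 1 := by
    simp only [φ, monoChar, zero_mul, Complex.ofReal_zero, Complex.exp_zero]
    exact colorAvg_const hc 1
  have hΨ0 : Ψ 0 = 0 := by simp [Ψ, poissonExponent]
  have hmv := Convex.norm_image_sub_le_of_norm_hasDerivWithin_le (s := Set.univ) (x := 0) (y := t)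
    (fun s _ => (hd s).hasDerivWithinAt) (fun s _ => hb s) convex_univ (Set.mem_univ _)
    (Set.mem_univ _)
  rw [hφ0, hΨ0, neg_zero, Complex.exp_zero, mul_one, sub_zero, Real.norm_eq_abs] at hmv
  -- Multiplying back by $e^\Psi$ loses nothing, since $\mathrm{Re}\,\Psi\le0$.
  have e1 : φ t - Complex.exp (Ψ t) = (φ t * Complex.exp (-Ψ t) - 1) * Complex.exp (Ψ t) := by
    rw [sub_mul, mul_assoc, ← Complex.exp_add, neg_add_cancel, Complex.exp_zero]
    ring
  change ‖φ t - Complex.exp (Ψ t)‖ ≤ _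
  rw [e1, norm_mul]
  have h2 : ‖Complex.exp (Ψ t)‖ ≤ 1 := by
    rw [Complex.norm_exp]
    exact Real.exp_le_one_iff.2 (re_poissonExponent_nonpos t)
  calc _ ≤ ‖φ t * Complex.exp (-Ψ t) - 1‖ * 1 := mul_le_mul_of_nonneg_left h2 (norm_nonneg _)
    _ ≤ _ := by rw [mul_one]; exact hmv

end

/-! ### The overlaps are negligible -/

section Overlap

variable {V : Type*} [Fintype V] {c k : ℕ}

/-- Choose a common vertex in `S`; erasing it from `S'` leaves a set of `k - 1` vertices that
determines `S'`. -/
lemma card_meeting_le {S : Finset V} (hS : S.card = k) :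
    (meeting k S).card ≤ k * Fintype.card V ^ (k - 1) := by
  have hsub : meeting k S ⊆ S.biUnion fun v =>
      (Finset.powersetCard k Finset.univ).filter fun S' => v ∈ S' := by
    intro S' hS'
    obtain ⟨h1, h2⟩ := Finset.mem_filter.1 hS'
    obtain ⟨v, hv', hv⟩ := Finset.not_disjoint_iff.1 h2
    exact Finset.mem_biUnion.2 ⟨v, hv, Finset.mem_filter.2 ⟨h1, hv'⟩⟩
  refine (Finset.card_le_card hsub).trans (Finset.card_biUnion_le.trans ?_)
  rw [← hS, ← smul_eq_mul]
  refine Finset.sum_le_card_nsmul _ _ _ fun v _ => ?_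
  calc _ ≤ (Finset.powersetCard (S.card - 1) (Finset.univ : Finset V)).card := by
        refine Finset.card_le_card_of_injOn (fun S' => S'.erase v) ?_ ?_
        · intro S' hS'
          simp only [Finset.coe_filter, Finset.mem_powersetCard_univ, Set.mem_ofPred_eq] at hS'
          simp [Finset.card_erase_of_mem hS'.2, hS'.1]
        · intro S₁ h₁ S₂ h₂ h
          simp only [Finset.coe_filter, Set.mem_ofPred_eq] at h₁ h₂
          simp only at h
          rw [← Finset.insert_erase h₁.2, ← Finset.insert_erase h₂.2, h]
    _ ≤ _ := by
        rw [Finset.card_powersetCard, Finset.card_univ]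
        exact Nat.choose_le_pow _ _

/-- The bound isolates the factor $N^k/c^{k-1}$, which stays bounded, from a power of $N/c$, which
vanishes in the limit when $k\ge2$. -/
lemma overlapProd_le :
    overlapProd V c k ≤ k * ((Fintype.card V : ℝ) ^ k / (c : ℝ) ^ (k - 1))
      * ((Fintype.card V : ℝ) / c) ^ (k - 1) := by
  have h1 : ∀ S ∈ Finset.powersetCard k (Finset.univ : Finset V),
      ∑ _S' ∈ meeting k S, ((c : ℝ) ^ (k - 1))⁻¹ * ((c : ℝ) ^ (k - 1))⁻¹
        ≤ (k * (Fintype.card V : ℝ) ^ (k - 1)) *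
          (((c : ℝ) ^ (k - 1))⁻¹ * ((c : ℝ) ^ (k - 1))⁻¹) := by
    intro S hS
    rw [Finset.sum_const, nsmul_eq_mul]
    refine mul_le_mul_of_nonneg_right ?_ (by positivity)
    exact_mod_cast card_meeting_le (Finset.mem_powersetCard_univ.1 hS)
  refine (Finset.sum_le_sum h1).trans ?_
  rw [Finset.sum_const, Finset.card_powersetCard, Finset.card_univ, nsmul_eq_mul]
  calc _ ≤ (Fintype.card V : ℝ) ^ k * ((k * (Fintype.card V : ℝ) ^ (k - 1)) *
          (((c : ℝ) ^ (k - 1))⁻¹ * ((c : ℝ) ^ (k - 1))⁻¹)) := by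
        refine mul_le_mul_of_nonneg_right ?_ (by positivity)
        exact_mod_cast Nat.choose_le_pow _ _
    _ = _ := by
        rw [div_pow, div_eq_mul_inv, div_eq_mul_inv]
        ring

/-- Here `D` stands for the new part `S' \ S` of an overlapping set. Size `d` contributes at most
$(N/c)^d\le N/c$, as $d\ge1$ and $N\le c$. -/
lemma sum_card_inv_pow_le (hN : Fintype.card V ≤ c) (hc : 0 < c) :
    ∑ D ∈ (Finset.univ : Finset (Finset V)).filter (fun D => D.card ∈ Finset.Ico 1 k),
      ((c : ℝ) ^ D.card)⁻¹ ≤ k * ((Fintype.card V : ℝ) / c) := by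
  rw [← Finset.sum_fiberwise_of_maps_to (t := Finset.Ico 1 k) (g := Finset.card)
    (fun D hD => (Finset.mem_filter.1 hD).2)]
  have hr : (Fintype.card V : ℝ) / c ≤ 1 := by
    rw [div_le_one (by exact_mod_cast hc)]
    exact_mod_cast hN
  calc _ ≤ ∑ _d ∈ Finset.Ico 1 k, ((Fintype.card V : ℝ) / c) := by
        refine Finset.sum_le_sum fun d hd => ?_
        have hd1 : d ≠ 0 := by have := (Finset.mem_Ico.1 hd).1; omega
        refine le_trans ?_ (pow_le_of_le_one (by positivity) hr hd1)
        rw [Finset.sum_congr rfl fun D hD => by rw [(Finset.mem_filter.1 hD).2], Finset.sum_const,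
          nsmul_eq_mul, div_pow, div_eq_mul_inv]
        refine mul_le_mul_of_nonneg_right ?_ (by positivity)
        have : ((Finset.univ.filter fun D : Finset V => D.card ∈ Finset.Ico 1 k).filter
            fun D => D.card = d).card ≤ (Finset.powersetCard d (Finset.univ : Finset V)).card := by
          refine Finset.card_le_card fun D hD => ?_
          exact Finset.mem_powersetCard_univ.2 (Finset.mem_filter.1 hD).2
        rw [Finset.card_powersetCard, Finset.card_univ] at this
        exact_mod_cast this.trans (Nat.choose_le_pow _ _)
    _ ≤ _ := by
        rw [Finset.sum_const, Nat.card_Ico, nsmul_eq_mul]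
        refine mul_le_mul_of_nonneg_right ?_ (by positivity)
        exact_mod_cast Nat.sub_le _ _

/-- `S'` is determined by `S' ∩ S`, with at most `2 ^ k` choices, and `S' \ S`. The latter has
between 1 and `k - 1` elements, because `S' ≠ S` has the size of `S` and meets it, and each of its
elements costs one further factor `1 / c`. -/
lemma sum_meeting_erase_le (hN : Fintype.card V ≤ c) (hc : 0 < c) {S : Finset V}
    (hS : S.card = k) :
    ∑ S' ∈ (meeting k S).erase S, ((c : ℝ) ^ ((S ∪ S').card - 1))⁻¹
      ≤ 2 ^ k * (k * ((Fintype.card V : ℝ) / c)) * ((c : ℝ) ^ (k - 1))⁻¹ := by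
  let D := (Finset.univ : Finset (Finset V)).filter fun D => D.card ∈ Finset.Ico 1 k
  let e : Finset V → Finset V × Finset V := fun S' => (S' ∩ S, S' \ S)
  have hinj : Set.InjOn e ((meeting k S).erase S) := by
    intro S₁ _ S₂ _ h
    simp only [e, Prod.mk.injEq] at h
    rw [← Finset.sdiff_union_inter S₁ S, ← Finset.sdiff_union_inter S₂ S, h.1, h.2]
  have hsub : ((meeting k S).erase S).image e ⊆ S.powerset ×ˢ D := by
    intro q hq
    obtain ⟨S', hS', rfl⟩ := Finset.mem_image.1 hq
    obtain ⟨hne, hm⟩ := Finset.mem_erase.1 hS'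
    have hk' := card_of_mem_meeting hm
    have hd := (Finset.mem_filter.1 hm).2
    have hpos : 0 < (S' ∩ S).card := by
      rw [Finset.card_pos]
      obtain ⟨v, hv', hv⟩ := Finset.not_disjoint_iff.1 hd
      exact ⟨v, Finset.mem_inter.2 ⟨hv', hv⟩⟩
    have hsum := Finset.card_inter_add_card_sdiff S' S
    have hpos' : 0 < (S' \ S).card := by
      rw [Finset.card_pos, Finset.sdiff_nonempty]
      intro hle
      exact hne (Finset.eq_of_subset_of_card_le hle (by omega))
    simp only [e, D, Finset.mem_product, Finset.mem_powerset, Finset.mem_filter, Finset.mem_univ,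
      true_and, Finset.mem_Ico]
    exact ⟨Finset.inter_subset_right, hpos', by omega⟩
  have h1 : ∀ S' ∈ (meeting k S).erase S, ((c : ℝ) ^ ((S ∪ S').card - 1))⁻¹
      = ((c : ℝ) ^ (e S').2.card)⁻¹ * ((c : ℝ) ^ (k - 1))⁻¹ := by
    intro S' hS'
    obtain ⟨hne, hm⟩ := Finset.mem_erase.1 hS'
    have hk' : 0 < k := by
      rw [← hS, Finset.card_pos]
      obtain ⟨v, hv', hv⟩ := Finset.not_disjoint_iff.1 (Finset.mem_filter.1 hm).2
      exact ⟨v, hv⟩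
    rw [← mul_inv, ← pow_add]
    congr 2
    have : (S ∪ S').card = S.card + (S' \ S).card := by
      rw [← Finset.union_sdiff_self_eq_union, Finset.card_union_of_disjoint Finset.disjoint_sdiff]
    simp only [e]
    omega
  rw [Finset.sum_congr rfl h1, ← Finset.sum_mul]
  refine mul_le_mul_of_nonneg_right ?_ (by positivity)
  rw [← Finset.sum_image (f := fun q : Finset V × Finset V => ((c : ℝ) ^ q.2.card)⁻¹) hinj]
  refine (Finset.sum_le_sum_of_subset_of_nonneg hsub fun _ _ _ => by positivity).trans ?_
  rw [Finset.sum_product]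
  simp only [Finset.sum_const, Finset.card_powerset, hS, nsmul_eq_mul]
  push_cast
  exact mul_le_mul_of_nonneg_left (sum_card_inv_pow_le hN hc) (by positivity)

lemma overlapJoint_le (hN : Fintype.card V ≤ c) (hc : 0 < c) :
    overlapJoint V c k ≤ 2 ^ k * k * ((Fintype.card V : ℝ) ^ k / (c : ℝ) ^ (k - 1))
      * ((Fintype.card V : ℝ) / c) := by
  refine (Finset.sum_le_sum fun S hS =>
    sum_meeting_erase_le hN hc (Finset.mem_powersetCard_univ.1 hS)).trans ?_
  rw [Finset.sum_const, Finset.card_powersetCard, Finset.card_univ, nsmul_eq_mul]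
  calc _ ≤ (Fintype.card V : ℝ) ^ k *
        (2 ^ k * (k * ((Fintype.card V : ℝ) / c)) * ((c : ℝ) ^ (k - 1))⁻¹) := by
        refine mul_le_mul_of_nonneg_right ?_ (by positivity)
        exact_mod_cast Nat.choose_le_pow _ _
    _ = _ := by
        rw [div_eq_mul_inv (_ ^ k)]
        ring

lemma overlapProd_nonneg : 0 ≤ overlapProd V c k :=
  Finset.sum_nonneg fun _ _ => Finset.sum_nonneg fun _ _ => by positivity

lemma overlapJoint_nonneg : 0 ≤ overlapJoint V c k :=
  Finset.sum_nonneg fun _ _ => Finset.sum_nonneg fun _ _ => by positivity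

end Overlap

/-- If `N / c → 0` while `N ^ k / c ^ (k - 1)` converges, the characteristic function of the
weighted number of monochromatic `k`-sets is asymptotically that of a compound Poisson law. -/
theorem tendsto_monoChar_sub_exp {k : ℕ} (hk : 2 ≤ k) {N c : ℕ → ℕ} (hc : ∀ᶠ n in atTop, 0 < c n)
    {κ : ℝ} (hκ : Tendsto (fun n => (N n : ℝ) ^ k / (c n : ℝ) ^ (k - 1)) atTop (𝓝 κ))
    (hr : Tendsto (fun n => (N n : ℝ) / c n) atTop (𝓝 0))
    {w : (n : ℕ) → Finset (Fin (N n)) → ℝ} {M : ℝ}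
    (hM : ∀ n (S : Finset (Fin (N n))), S.card = k → |w n S| ≤ M) (t : ℝ) :
    Tendsto (fun n => monoChar (c n) k (w n) t - Complex.exp (poissonExponent (c n) k (w n) t))
      atTop (𝓝 0) := by
  have hle : ∀ᶠ n in atTop, N n ≤ c n := by
    filter_upwards [hc, hr.eventually_lt_const one_pos] with n h1 h2
    rw [div_lt_one (by exact_mod_cast h1)] at h2
    exact_mod_cast h2.le
  have hP : Tendsto (fun n => overlapProd (Fin (N n)) (c n) k) atTop (𝓝 0) := by
    have h1 : Tendsto (fun n => k * ((N n : ℝ) ^ k / (c n : ℝ) ^ (k - 1))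
        * ((N n : ℝ) / c n) ^ (k - 1)) atTop (𝓝 (k * κ * 0 ^ (k - 1))) :=
      (hκ.const_mul _).mul (hr.pow _)
    rw [zero_pow (by omega), mul_zero] at h1
    refine squeeze_zero (fun n => overlapProd_nonneg) (fun n => ?_) h1
    simpa using overlapProd_le (V := Fin (N n)) (c := c n) (k := k)
  have hJ : Tendsto (fun n => overlapJoint (Fin (N n)) (c n) k) atTop (𝓝 0) := by
    have h1 : Tendsto (fun n => 2 ^ k * k * ((N n : ℝ) ^ k / (c n : ℝ) ^ (k - 1))
        * ((N n : ℝ) / c n)) atTop (𝓝 (2 ^ k * k * κ * 0)) :=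
      (hκ.const_mul _).mul hr
    rw [mul_zero] at h1
    refine squeeze_zero' (Eventually.of_forall fun n => overlapJoint_nonneg) ?_ h1
    filter_upwards [hc, hle] with n h2 h3
    simpa using overlapJoint_le (V := Fin (N n)) (c := c n) (k := k) (by simpa using h3) h2
  have hlim : Tendsto (fun n => M * (2 * overlapJoint (Fin (N n)) (c n) k
      + 2 * overlapProd (Fin (N n)) (c n) k)
        * Real.exp (2 * ((N n : ℝ) ^ k / (c n : ℝ) ^ (k - 1))) * |t|) atTop
      (𝓝 (M * (2 * 0 + 2 * 0) * Real.exp (2 * κ) * |t|)) :=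
    ((((hJ.const_mul _).add (hP.const_mul _)).const_mul _).mul
      ((Real.continuous_exp.tendsto _).comp (hκ.const_mul _))).mul_const _
  simp only [mul_zero, add_zero, zero_mul] at hlim
  refine squeeze_zero_norm' ?_ hlim
  filter_upwards [hc] with n h2
  simpa using norm_monoChar_sub_exp_le (V := Fin (N n)) (w := w n) h2 (by omega) (hM n) t

/-! ### Homomorphism densities -/

section Density

variable {k N : ℕ}

/-- The graph `F` with the pairs in `T` added as edges. -/
def addPairs (F : SimpleGraph (Fin k)) (T : Finset (Fin k × Fin k)) : SimpleGraph (Fin k) :=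
  F ⊔ SimpleGraph.fromRel fun a b => (a, b) ∈ T

lemma edgePairs_addPairs (F : SimpleGraph (Fin k)) {T : Finset (Fin k × Fin k)}
    (hT : T ⊆ nonEdgePairs F) : edgePairs (addPairs F T) = edgePairs F ∪ T := by
  have hT' : ∀ p ∈ T, p.1 < p.2 := fun p hp => by
    have := hT hp
    simp only [nonEdgePairs, Finset.mem_filter] at this
    exact this.2.1
  ext ⟨a, b⟩
  simp only [edgePairs, addPairs, Finset.mem_filter, Finset.mem_univ, true_and, Finset.mem_union,
    SimpleGraph.sup_adj, SimpleGraph.fromRel_adj]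
  constructor
  · rintro ⟨hab, h | ⟨-, h | h⟩⟩
    · exact Or.inl ⟨hab, h⟩
    · exact Or.inr h
    · exact absurd (hT' _ h) hab.asymm
  · rintro (⟨hab, h⟩ | h)
    · exact ⟨hab, Or.inl h⟩
    · exact ⟨hT' _ h, Or.inr ⟨(hT' _ h).ne, Or.inl h⟩⟩

lemma disjoint_edgePairs (F : SimpleGraph (Fin k)) {T : Finset (Fin k × Fin k)}
    (hT : T ⊆ nonEdgePairs F) : Disjoint (edgePairs F) T := by
  refine Finset.disjoint_left.2 fun p hp hp' => ?_
  have := hT hp'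
  simp only [nonEdgePairs, edgePairs, Finset.mem_filter] at this hp
  exact this.2.2 hp.2.2

/-- Inclusion-exclusion over the non-edges. -/
lemma prod_edgePairs_mul_prod_nonEdgePairs (F : SimpleGraph (Fin k)) (w : Fin k × Fin k → ℝ) :
    (∏ p ∈ edgePairs F, w p) * ∏ p ∈ nonEdgePairs F, (1 - w p)
      = ∑ T ∈ (nonEdgePairs F).powerset, (-1) ^ T.card * ∏ p ∈ edgePairs (addPairs F T), w p := by
  have h1 : ∏ p ∈ nonEdgePairs F, (1 - w p)
      = ∑ T ∈ (nonEdgePairs F).powerset, (-1) ^ T.card * ∏ p ∈ T, w p := by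
    have := Finset.prod_add (fun p => - w p) (fun _ => (1 : ℝ)) (nonEdgePairs F)
    simp only [Finset.prod_const_one, mul_one, Finset.prod_neg] at this
    rw [← this]
    exact Finset.prod_congr rfl fun p _ => by ring
  rw [h1, Finset.mul_sum]
  refine Finset.sum_congr rfl fun T hT => ?_
  have hT := Finset.mem_powerset.1 hT
  rw [edgePairs_addPairs F hT, Finset.prod_union (disjoint_edgePairs F hT)]
  ring

lemma prod_adj_eq_ite (H : SimpleGraph (Fin k)) (G : SimpleGraph (Fin N)) (s : Fin k → Fin N) :
    ∏ p ∈ edgePairs H, G.adjMatrix ℝ (s p.1) (s p.2)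
      = if ∀ a b, H.Adj a b → G.Adj (s a) (s b) then 1 else 0 := by
  split_ifs with h
  · refine Finset.prod_eq_one fun p hp => ?_
    simp only [edgePairs, Finset.mem_filter] at hp
    simp [SimpleGraph.adjMatrix_apply, h _ _ hp.2.2]
  · push Not at h
    obtain ⟨a, b, hab, hG⟩ := h
    rcases lt_or_gt_of_ne hab.ne with hlt | hlt
    · refine Finset.prod_eq_zero (i := (a, b)) (by simp [edgePairs, hlt, hab]) ?_
      simp [SimpleGraph.adjMatrix_apply, hG]
    · refine Finset.prod_eq_zero (i := (b, a)) (by simp [edgePairs, hlt, hab.symm]) ?_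
      simp [SimpleGraph.adjMatrix_apply, G.adj_comm, hG]

lemma homDensity_eq_sum (F : SimpleGraph (Fin k)) (G : SimpleGraph (Fin N)) :
    homDensity F G
      = (∑ s : Fin k → Fin N, ∏ p ∈ edgePairs F, G.adjMatrix ℝ (s p.1) (s p.2)) / (N : ℝ) ^ k := by
  simp only [homDensity, prod_adj_eq_ite]
  rw [Finset.sum_boole]
  congr 2
  rw [← Fintype.card_subtype, ← Nat.card_eq_fintype_card]
  exact Nat.card_congr
    { toFun := fun f => ⟨f, fun _ _ => f.map_adj⟩
      invFun := fun s => ⟨s.1, fun {a b} => s.2 a b⟩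
      left_inv := fun _ => rfl
      right_inv := fun _ => rfl }

/-- The induced product is the indicator that `G` pulls back to `F`. -/
lemma prod_adj_mul_prod_eq_ite (F : SimpleGraph (Fin k)) (G : SimpleGraph (Fin N))
    (s : Fin k → Fin N) :
    (∏ p ∈ edgePairs F, G.adjMatrix ℝ (s p.1) (s p.2))
        * ∏ p ∈ nonEdgePairs F, (1 - G.adjMatrix ℝ (s p.1) (s p.2))
      = if G.comap s = F then 1 else 0 := by
  split_ifs with h
  · have h' : ∀ a b, G.Adj (s a) (s b) ↔ F.Adj a b := fun a b => by rw [← h]; rfl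
    rw [Finset.prod_eq_one, Finset.prod_eq_one, one_mul]
    · intro p hp
      simp only [nonEdgePairs, Finset.mem_filter] at hp
      simp [SimpleGraph.adjMatrix_apply, h', hp.2.2]
    · intro p hp
      simp only [edgePairs, Finset.mem_filter] at hp
      simp [SimpleGraph.adjMatrix_apply, h', hp.2.2]
  · by_contra hne
    obtain ⟨h1, h2⟩ := mul_ne_zero_iff.1 hne
    rw [Finset.prod_ne_zero_iff] at h1 h2
    refine h ?_
    have key : ∀ a b, a < b → (G.Adj (s a) (s b) ↔ F.Adj a b) := by
      intro a b hab
      constructor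
      · intro hG
        by_contra hF
        exact h2 (a, b) (by simp [nonEdgePairs, hab, hF])
          (by simp [SimpleGraph.adjMatrix_apply, hG])
      · intro hF
        by_contra hG
        exact h1 (a, b) (by simp [edgePairs, hab, hF]) (by simp [SimpleGraph.adjMatrix_apply, hG])
    ext a b
    rw [SimpleGraph.comap_adj]
    rcases lt_trichotomy a b with hab | rfl | hab
    · exact key a b hab
    · simp
    · rw [G.adj_comm, F.adj_comm]
      exact key b a hab

lemma Graphon.measurable_prod (W : Graphon) (P : Finset (Fin k × Fin k)) :
    Measurable fun x : Fin k → unitInterval => ∏ p ∈ P, W.toFun (x p.1) (x p.2) := by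
  refine Finset.measurable_fun_prod _ fun p _ => ?_
  have h : Measurable fun x : Fin k → unitInterval => (x p.1, x p.2) := by fun_prop
  exact W.measurable'.comp h

lemma Graphon.integrable_prod (W : Graphon) (P : Finset (Fin k × Fin k)) :
    Integrable fun x : Fin k → unitInterval => ∏ p ∈ P, W.toFun (x p.1) (x p.2) := by
  refine Integrable.of_bound (W.measurable_prod P).aestronglyMeasurable 1 (.of_forall fun x => ?_)
  rw [norm_prod]
  refine Finset.prod_le_one (fun _ _ => norm_nonneg _) fun p _ => ?_
  obtain ⟨h0, h1⟩ := W.mem_Icc' (x p.1) (x p.2)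
  rwa [Real.norm_of_nonneg h0]

/-- Expresses induced densities through homomorphism densities, whose convergence is what graphon
convergence provides. -/
lemma Graphon.indDensity_eq_sum (F : SimpleGraph (Fin k)) (W : Graphon) :
    W.indDensity F
      = ∑ T ∈ (nonEdgePairs F).powerset, (-1) ^ T.card * W.homDensity (addPairs F T) := by
  simp only [Graphon.indDensity, Graphon.homDensity]
  simp only [prod_edgePairs_mul_prod_nonEdgePairs F]
  rw [integral_finsetSum _ fun T _ => (W.integrable_prod _).const_mul _]
  exact Finset.sum_congr rfl fun T _ => integral_const_mul _ _

lemma Graphon.indDensity_nonneg (F : SimpleGraph (Fin k)) (W : Graphon) : 0 ≤ W.indDensity F := by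
  refine integral_nonneg fun x => mul_nonneg (Finset.prod_nonneg fun p _ => ?_)
    (Finset.prod_nonneg fun p _ => ?_)
  · exact (W.mem_Icc' _ _).1
  · exact sub_nonneg.2 (W.mem_Icc' _ _).2

end Density

/-! ### Limits of induced and of injective densities -/

section Limits

variable {k : ℕ} {N : ℕ → ℕ} {G : (n : ℕ) → SimpleGraph (Fin (N n))} {W : Graphon}

/-- The same inclusion-exclusion holds in $G_n$ and in $W$, so the limit is taken term by term. -/
lemma ConvergesToGraphon.tendsto_sum_comap (hG : ConvergesToGraphon G W)
    (F : SimpleGraph (Fin k)) :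
    Tendsto (fun n => (∑ s : Fin k → Fin (N n), if (G n).comap s = F then (1 : ℝ) else 0)
      / (N n : ℝ) ^ k) atTop (𝓝 (W.indDensity F)) := by
  rw [W.indDensity_eq_sum]
  have h1 : Tendsto (fun n => ∑ T ∈ (nonEdgePairs F).powerset,
      (-1) ^ T.card * homDensity (addPairs F T) (G n)) atTop
      (𝓝 (∑ T ∈ (nonEdgePairs F).powerset, (-1) ^ T.card * W.homDensity (addPairs F T))) :=
    tendsto_finsetSum _ fun T _ => (hG k (addPairs F T)).const_mul _
  refine h1.congr fun n => ?_
  have h2 : ∀ s : Fin k → Fin (N n), (if (G n).comap s = F then (1 : ℝ) else 0)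
      = ∑ T ∈ (nonEdgePairs F).powerset, (-1) ^ T.card *
        ∏ p ∈ edgePairs (addPairs F T), (G n).adjMatrix ℝ (s p.1) (s p.2) := fun s => by
    rw [← prod_adj_mul_prod_eq_ite]
    exact prod_edgePairs_mul_prod_nonEdgePairs F fun p => (G n).adjMatrix ℝ (s p.1) (s p.2)
  simp only [h2, homDensity_eq_sum]
  rw [Finset.sum_comm, Finset.sum_div]
  refine Finset.sum_congr rfl fun T _ => ?_
  rw [← Finset.mul_sum, mul_div_assoc]

lemma sum_embedding_eq {k N : ℕ} (f : (Fin k → Fin N) → ℝ) :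
    ∑ s : Fin k ↪ Fin N, f s = ∑ s with Function.Injective s, f s := by
  rw [Finset.sum_subtype (p := Function.Injective) _ (by simp) f]
  exact (Fintype.sum_equiv (Equiv.subtypeInjectiveEquivEmbedding _ _) _ _ fun _ => rfl).symm

/-- Restricting a bounded sum over maps to the injective maps does not change its limit. -/
lemma tendsto_sum_embedding {f : (n : ℕ) → (Fin k → Fin (N n)) → ℝ}
    (h0 : ∀ n s, 0 ≤ f n s) (h1 : ∀ n s, f n s ≤ 1) (hN : Tendsto N atTop atTop) {L : ℝ}
    (hL : Tendsto (fun n => (∑ s, f n s) / (N n : ℝ) ^ k) atTop (𝓝 L)) :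
    Tendsto (fun n => (∑ s : Fin k ↪ Fin (N n), f n s) / (N n : ℝ) ^ k) atTop (𝓝 L) := by
  -- This is the proportion of non-injective maps, which bounds the difference of the two normalised
  -- sums since `f` takes values in $[0,1]$.
  have hd : Tendsto (fun n => 1 - ((N n).descFactorial k : ℝ) / (N n : ℝ) ^ k) atTop (𝓝 0) := by
    have h2 : Tendsto (fun m : ℕ => (m.descFactorial k : ℝ) / (m : ℝ) ^ k) atTop (𝓝 1) := by
      refine (Asymptotics.isEquivalent_iff_tendsto_one ?_).1 (isEquivalent_descFactorial k)
      filter_upwards [eventually_gt_atTop 0] with m hm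
      positivity
    simpa using (h2.comp hN).const_sub 1
  have hdiff : Tendsto (fun n => (∑ s, f n s) / (N n : ℝ) ^ k
      - (∑ s : Fin k ↪ Fin (N n), f n s) / (N n : ℝ) ^ k) atTop (𝓝 0) := by
    refine squeeze_zero' (Eventually.of_forall fun n => ?_) ?_ hd
    · rw [sum_embedding_eq, ← sub_div]
      refine div_nonneg (sub_nonneg.2 ?_) (by positivity)
      exact Finset.sum_le_sum_of_subset_of_nonneg (Finset.filter_subset _ _) fun s _ _ => h0 n s
    · filter_upwards [hN.eventually_gt_atTop 0] with n hn
      have hpos : (0 : ℝ) < (N n : ℝ) ^ k := by positivity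
      rw [← sub_div, one_sub_div hpos.ne']
      refine div_le_div_of_nonneg_right ?_ hpos.le
      have e1 : ((N n).descFactorial k : ℝ) = ∑ s : Fin k ↪ Fin (N n), 1 := by
        simp [Fintype.card_embedding_eq]
      have e2 : (N n : ℝ) ^ k = ∑ s : Fin k → Fin (N n), 1 := by simp
      rw [e1, e2, sum_embedding_eq (fun _ => 1), sum_embedding_eq,
        ← Finset.sum_filter_add_sum_filter_not Finset.univ
          (fun s : Fin k → Fin (N n) => Function.Injective s) (f n),
        ← Finset.sum_filter_add_sum_filter_not Finset.univ
          (fun s : Fin k → Fin (N n) => Function.Injective s) (fun _ => (1 : ℝ)),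
        add_sub_cancel_left, add_sub_cancel_left]
      exact Finset.sum_le_sum fun s _ => h1 n s
  simpa using hL.sub hdiff

lemma ConvergesToGraphon.tendsto_comap (hG : ConvergesToGraphon G W)
    (hN : Tendsto N atTop atTop) (F : SimpleGraph (Fin k)) :
    Tendsto (fun n => (∑ s : Fin k ↪ Fin (N n), if (G n).comap s = F then (1 : ℝ) else 0)
      / (N n : ℝ) ^ k) atTop (𝓝 (W.indDensity F)) := by
  refine tendsto_sum_embedding (f := fun n s => if (G n).comap s = F then (1 : ℝ) else 0)
    (fun n s => ?_) (fun n s => ?_) hN (hG.tendsto_sum_comap F) <;>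
  · split_ifs <;> norm_num

lemma ConvergesToGraphon.tendsto_embedding (hG : ConvergesToGraphon G W)
    (hN : Tendsto N atTop atTop) (F : SimpleGraph (Fin k)) :
    Tendsto (fun n => (∑ s : Fin k ↪ Fin (N n),
      ∏ p ∈ edgePairs F, (G n).adjMatrix ℝ (s p.1) (s p.2)) / (N n : ℝ) ^ k) atTop
      (𝓝 (W.homDensity F)) := by
  refine tendsto_sum_embedding
    (f := fun n s => ∏ p ∈ edgePairs F, (G n).adjMatrix ℝ (s p.1) (s p.2))
    (fun n s => ?_) (fun n s => ?_) hN ?_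
  · rw [prod_adj_eq_ite]
    split_ifs <;> norm_num
  · rw [prod_adj_eq_ite]
    split_ifs <;> norm_num
  · simpa only [homDensity_eq_sum] using hG k F

/-- The induced density is an isomorphism invariant. -/
lemma ConvergesToGraphon.indDensity_congr (hG : ConvergesToGraphon G W)
    {F F' : SimpleGraph (Fin k)} (e : F ≃g F') : W.indDensity F = W.indDensity F' := by
  -- Both densities are limits of counts in $G_n$, and these counts agree because relabelling
  -- permutes the maps `s`. No change of variables in the integral is needed.
  refine tendsto_nhds_unique (hG.tendsto_sum_comap F) ((hG.tendsto_sum_comap F').congr fun n => ?_)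
  congr 1
  refine Fintype.sum_equiv (Equiv.arrowCongr e.toEquiv.symm (Equiv.refl _)) _ _ fun s => ?_
  have : (G n).comap s = F' ↔ (G n).comap (s ∘ e) = F := by
    have hF : F'.comap e = F := by
      ext a b
      exact e.map_adj_iff
    constructor
    · intro h
      rw [← SimpleGraph.comap_comap, h, hF]
    · intro h
      ext a b
      have := congrArg (fun K : SimpleGraph (Fin k) => K.Adj (e.symm a) (e.symm b)) h
      simpa [e.symm.map_adj_iff] using this
  simp only [this]
  rfl

end Limits

/-! ### Counting copies -/

section Copies

variable {k : ℕ}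

lemma finite_iso {α β : Type*} [Finite α] [Finite β] (A : SimpleGraph α) (B : SimpleGraph β) :
    Finite (A ≃g B) :=
  Finite.of_injective (fun e : A ≃g B => e.toEquiv) fun _ _ h => RelIso.toEquiv_injective h

lemma autCard_pos (F : SimpleGraph (Fin k)) : 0 < autCard F := by
  have : Nonempty (F ≃g F) := ⟨SimpleGraph.Iso.refl⟩
  have := finite_iso F F
  exact Nat.card_pos

lemma card_iso_eq_autCard {α : Type*} {F : SimpleGraph (Fin k)} {K : SimpleGraph α}
    (e : F ≃g K) : Nat.card (F ≃g K) = autCard F :=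
  Nat.card_congr
    { toFun := fun f => f.trans e.symm
      invFun := fun f => f.trans e
      left_inv := fun f => by ext; simp
      right_inv := fun f => by ext; simp }

/-- The labelled copies whose image is a given subgraph are the isomorphisms onto it. -/
def isoEquivCopyFiber {α β : Type*} {A : SimpleGraph α} {B : SimpleGraph β} (B' : B.Subgraph) :
    (A ≃g B'.coe) ≃ {f : A.Copy B // f.toSubgraph = B'} := by
  refine Equiv.ofBijective
    (fun e => ⟨⟨B'.hom.comp e.toHom, SimpleGraph.Subgraph.hom_injective.comp e.injective⟩, by
      simp [SimpleGraph.Copy.toSubgraph, SimpleGraph.Subgraph.map_comp]⟩) ⟨?_, ?_⟩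
  · intro e e' h
    ext a
    have := congrArg (fun f => f.1 a) h
    exact this
  · rintro ⟨f, rfl⟩
    exact ⟨f.isoToSubgraph, rfl⟩

lemma labelledCopyCount_eq_card {α β : Type*} [Fintype α] [Fintype β] (F : SimpleGraph α)
    (H : SimpleGraph β) : F.labelledCopyCount H = Nat.card (H.Copy F) := by
  rw [SimpleGraph.labelledCopyCount, Nat.card_eq_fintype_card]

/-- Sort the labelled copies by their image: each subgraph isomorphic to `H` is the image of
`autCard H` of them. -/
lemma labelledCopyCount_eq_autCard_mul {α : Type*} [Fintype α] (H : SimpleGraph (Fin k))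
    (F : SimpleGraph α) : F.labelledCopyCount H = autCard H * F.copyCount H := by
  have e : H.Copy F ≃ Σ F' : F.Subgraph, (H ≃g F'.coe) :=
    (Equiv.sigmaFiberEquiv SimpleGraph.Copy.toSubgraph).symm.trans
      (Equiv.sigmaCongrRight fun F' => (isoEquivCopyFiber F').symm)
  have hfin : ∀ F' : F.Subgraph, Finite (H ≃g F'.coe) := fun F' => finite_iso _ _
  have hcard : ∀ F' : F.Subgraph,
      Nat.card (H ≃g F'.coe) = if Nonempty (H ≃g F'.coe) then autCard H else 0 := by
    intro F'
    split_ifs with h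
    · exact card_iso_eq_autCard h.some
    · rw [not_nonempty_iff] at h
      exact Nat.card_of_isEmpty
  rw [labelledCopyCount_eq_card, Nat.card_congr e, Nat.card_sigma]
  simp only [hcard]
  rw [← Finset.sum_filter, Finset.sum_const, smul_eq_mul, mul_comm, SimpleGraph.copyCount]

lemma copyCount_congr {F F' : SimpleGraph (Fin k)} (H : SimpleGraph (Fin k)) (e : F ≃g F') :
    F.copyCount H = F'.copyCount H := by
  refine Nat.eq_of_mul_eq_mul_left (autCard_pos H) ?_
  rw [← labelledCopyCount_eq_autCard_mul, ← labelledCopyCount_eq_autCard_mul,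
    labelledCopyCount_eq_card, labelledCopyCount_eq_card]
  exact Nat.card_congr
    { toFun := fun f => e.toCopy.comp f
      invFun := fun f => e.symm.toCopy.comp f
      left_inv := fun f => by ext; simp
      right_inv := fun f => by ext; simp }

lemma autCard_congr {F F' : SimpleGraph (Fin k)} (e : F ≃g F') : autCard F = autCard F' := by
  rw [← card_iso_eq_autCard e, ← card_iso_eq_autCard e.symm]
  exact Nat.card_congr
    { toFun := fun f => f.symm
      invFun := fun f => f.symm
      left_inv := fun f => rfl
      right_inv := fun f => rfl }

/-- The number of labelled graphs isomorphic to a given one, by orbit-stabilizer. -/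
lemma card_filter_iso_mul_autCard (F : SimpleGraph (Fin k)) :
    (Finset.univ.filter fun K : SimpleGraph (Fin k) => Nonempty (K ≃g F)).card * autCard F
      = k.factorial := by
  have h1 : (Finset.univ : Finset (Equiv.Perm (Fin k))).card = k.factorial := by
    rw [Finset.card_univ, Fintype.card_perm, Fintype.card_fin]
  -- The permutations are sorted by the pullback of `F`; the fibre over `K` is the set of
  -- isomorphisms `K ≃g F`, of size `autCard F`.
  rw [← h1, Finset.card_eq_sum_card_fiberwise (f := fun σ : Equiv.Perm (Fin k) => F.comap σ)
      (t := Finset.univ.filter fun K : SimpleGraph (Fin k) => Nonempty (K ≃g F))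
      (fun σ _ => by simpa using ⟨SimpleGraph.Iso.comap σ F⟩)]
  symm
  refine Finset.sum_const_nat fun K hK => ?_
  obtain ⟨e⟩ := (Finset.mem_filter.1 hK).2
  rw [← autCard_congr e, ← card_iso_eq_autCard e, ← Fintype.card_subtype,
    ← Nat.card_eq_fintype_card]
  exact Nat.card_congr
    { toFun := fun σ => ⟨σ.1, fun {a b} => by
        have := congrArg (fun K' : SimpleGraph (Fin k) => K'.Adj a b) σ.2
        exact iff_of_eq this⟩
      invFun := fun f => ⟨f.toEquiv, by ext a b; exact f.map_adj_iff⟩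
      left_inv := fun _ => rfl
      right_inv := fun _ => rfl }

/-- A sum over labelled graphs as a sum over isomorphism classes. -/
lemma IsSupergraphList.sum_eq {H : SimpleGraph (Fin k)} {R : Finset (SimpleGraph (Fin k))}
    (hR : IsSupergraphList H R) (g : SimpleGraph (Fin k) → ℂ)
    (hg : ∀ F F' : SimpleGraph (Fin k), Nonempty (F ≃g F') → g F = g F')
    (h0 : ∀ F, ¬ H.IsContained F → g F = 0) :
    ∑ F, g F = ∑ F ∈ R, (k.factorial / autCard F : ℂ) * g F := by
  have h1 : ∀ F ∈ R, (k.factorial / autCard F : ℂ) * g F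
      = ∑ K : SimpleGraph (Fin k), if Nonempty (K ≃g F) then g K else 0 := by
    intro F _
    rw [← Finset.sum_filter, Finset.sum_congr rfl fun K hK => hg K F (Finset.mem_filter.1 hK).2,
      Finset.sum_const, nsmul_eq_mul, ← card_filter_iso_mul_autCard F]
    have : (autCard F : ℂ) ≠ 0 := by exact_mod_cast (autCard_pos F).ne'
    push_cast
    rw [mul_div_cancel_right₀ _ this]
  rw [Finset.sum_congr rfl h1, Finset.sum_comm]
  refine Finset.sum_congr rfl fun K _ => ?_
  by_cases hK : H.IsContained K
  · obtain ⟨F, ⟨hF, hiso⟩, huniq⟩ := hR.2 K hK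
    rw [Finset.sum_eq_single_of_mem F hF, if_pos hiso]
    intro F' hF' hne
    rw [if_neg fun h => hne (huniq F' ⟨hF', h⟩)]
  · rw [h0 K hK]
    simp

end Copies

/-! ### Monochromatic copies as a weighted number of monochromatic sets -/

section Weight

variable {h N : ℕ}

/-- The number of copies of `H` in `G` with vertex set `S`. -/
def copyWeight (H : SimpleGraph (Fin h)) (G : SimpleGraph (Fin N)) (S : Finset (Fin N)) : ℝ :=
  (1 / (autCard H : ℝ)) * ∑ s : Fin h ↪ Fin N with Finset.univ.map s = S,
    ∏ p ∈ edgePairs H, G.adjMatrix ℝ (s p.1) (s p.2)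

lemma monoCopies_eq_monoWeight {c : ℕ} (H : SimpleGraph (Fin h)) (G : SimpleGraph (Fin N))
    (x : Fin N → Fin c) : monoCopies H G x = monoWeight h (copyWeight H G) x := by
  simp only [monoCopies, monoWeight, copyWeight, mul_assoc]
  rw [← Finset.mul_sum]
  congr 1
  rw [← Finset.sum_fiberwise_of_maps_to (s := Finset.univ)
    (t := Finset.powersetCard h (Finset.univ : Finset (Fin N)))
    (g := fun s : Fin h ↪ Fin N => Finset.univ.map s) (fun s _ => by simp)]
  refine Finset.sum_congr rfl fun S _ => ?_
  rw [Finset.sum_mul]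
  refine Finset.sum_congr rfl fun s hs => ?_
  have hs := (Finset.mem_filter.1 hs).2
  have : IsMono S x ↔ ∀ a b, x (s a) = x (s b) := by
    simp [← hs, IsMono]
  simp only [monoInd, this]

/-- The embeddings that preserve `H` and have the image of `s` factor uniquely through `s`, as
labelled copies of `H` in `G.comap s`. The weight of a set therefore depends only on the graph
induced on it. -/
lemma copyWeight_map (H : SimpleGraph (Fin h)) (G : SimpleGraph (Fin N)) (s : Fin h ↪ Fin N) :
    copyWeight H G (Finset.univ.map s) = (G.comap s).copyCount H := by
  have hpos : (autCard H : ℝ) ≠ 0 := by exact_mod_cast (autCard_pos H).ne'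
  have h1 : ∑ s' : Fin h ↪ Fin N with Finset.univ.map s' = Finset.univ.map s,
      ∏ p ∈ edgePairs H, G.adjMatrix ℝ (s' p.1) (s' p.2)
      = ((G.comap s).labelledCopyCount H : ℝ) := by
    simp only [fun s' : Fin h ↪ Fin N => prod_adj_eq_ite H G s']
    rw [Finset.sum_boole, Finset.filter_filter, labelledCopyCount_eq_card,
      ← Fintype.card_subtype, ← Nat.card_eq_fintype_card]
    congr 1
    symm
    refine Nat.card_congr (Equiv.ofBijective
      (fun f => ⟨f.toEmbedding.trans s, ?_⟩) ⟨?_, ?_⟩)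
    · constructor
      · rw [← Finset.map_map]
        congr 1
        exact Finset.map_univ_equiv (Equiv.ofBijective f
          (Finite.injective_iff_bijective.1 f.injective))
      · intro a b hab
        exact f.toHom.map_adj hab
    · intro f f' hff
      ext a
      have := DFunLike.congr_fun (congrArg Subtype.val hff) a
      exact congrArg Fin.val (s.injective this)
    · rintro ⟨s', hm, hadj⟩
      have hr : ∀ a, ∃ b, s b = s' a := by
        intro a
        have : s' a ∈ Finset.univ.map s := by
          rw [← hm]
          simp
        simpa using this
      choose f hf using hr
      refine ⟨⟨⟨f, fun {a b} hab => ?_⟩, fun a b hab => ?_⟩, ?_⟩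
      · rw [SimpleGraph.comap_adj, hf, hf]
        exact hadj a b hab
      · have hab : f a = f b := hab
        exact s'.injective (by rw [← hf, ← hf, hab])
      · ext a
        exact congrArg Fin.val (hf a)
  rw [copyWeight, h1, labelledCopyCount_eq_autCard_mul]
  push_cast
  rw [one_div, inv_mul_cancel_left₀ hpos]

/-- A sum over the `h`-subsets as an average over the embeddings. -/
lemma sum_powersetCard_eq_sum_embedding (g : Finset (Fin N) → ℂ) :
    ∑ S ∈ Finset.powersetCard h Finset.univ, g S
      = (h.factorial : ℂ)⁻¹ * ∑ s : Fin h ↪ Fin N, g (Finset.univ.map s) := by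
  rw [← Finset.sum_fiberwise_of_maps_to (s := Finset.univ)
    (t := Finset.powersetCard h (Finset.univ : Finset (Fin N)))
    (g := fun s : Fin h ↪ Fin N => Finset.univ.map s) (fun s _ => by simp), Finset.mul_sum]
  refine Finset.sum_congr rfl fun S hS => ?_
  rw [Finset.sum_congr rfl fun s hs => by rw [(Finset.mem_filter.1 hs).2], Finset.sum_const,
    nsmul_eq_mul]
  have hcard : (Finset.univ.filter fun s : Fin h ↪ Fin N => Finset.univ.map s = S).card
      = h.factorial := by
    have hS := Finset.mem_powersetCard_univ.1 hS
    have e : {s : Fin h ↪ Fin N // Finset.univ.map s = S} ≃ (Fin h ↪ S) :=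
      { toFun := fun s => ⟨fun a => ⟨s.1 a, by
          have := Finset.mem_map_of_mem s.1 (Finset.mem_univ a)
          rwa [s.2] at this⟩, fun a b hab =>
          s.1.injective (congrArg Subtype.val hab)⟩
        invFun := fun s => ⟨s.trans (Function.Embedding.subtype _), by
          refine Finset.eq_of_subset_of_card_le (fun v hv => ?_) (by simp [hS])
          obtain ⟨a, -, rfl⟩ := Finset.mem_map.1 hv
          exact (s a).2⟩
        left_inv := fun _ => rfl
        right_inv := fun _ => rfl }
    rw [← Fintype.card_subtype, Fintype.card_congr e, Fintype.card_embedding_eq]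
    simp [hS, Nat.descFactorial_self]
  have hne : (h.factorial : ℂ) ≠ 0 := by exact_mod_cast h.factorial_ne_zero
  rw [hcard, inv_mul_cancel_left₀ hne]

/-- A bound independent of `N` and `G`, since only finitely many graphs on `Fin h` can be induced;
it serves as the constant `M` of the Poisson approximation. -/
lemma abs_copyWeight_le (H : SimpleGraph (Fin h)) (G : SimpleGraph (Fin N)) {S : Finset (Fin N)}
    (hS : S.card = h) :
    |copyWeight H G S| ≤ ∑ F : SimpleGraph (Fin h), (F.copyCount H : ℝ) := by
  obtain ⟨s, rfl⟩ : ∃ s : Fin h ↪ Fin N, Finset.univ.map s = S :=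
    ⟨(S.orderEmbOfFin hS).toEmbedding, by
      ext v
      rw [← Finset.mem_coe, Finset.coe_map, Finset.coe_univ, Set.image_univ]
      exact Set.ext_iff.1 (S.range_orderEmbOfFin hS) v⟩
  rw [copyWeight_map, abs_of_nonneg (Nat.cast_nonneg _)]
  exact Finset.single_le_sum (f := fun F : SimpleGraph (Fin h) => (F.copyCount H : ℝ))
    (fun F _ => Nat.cast_nonneg _) (Finset.mem_univ _)

end Weight

/-! ### The expected number of monochromatic copies -/

section Mean

variable {h N c : ℕ}

lemma colorAvg_monoCopies (hc : 0 < c) (hh : 0 < h) (H : SimpleGraph (Fin h))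
    (G : SimpleGraph (Fin N)) :
    colorAvg (fun x : Fin N → Fin c => monoCopies H G x)
      = (1 / (autCard H : ℝ)) * ((∑ s : Fin h ↪ Fin N,
          ∏ p ∈ edgePairs H, G.adjMatrix ℝ (s p.1) (s p.2)) * ((c : ℝ) ^ (h - 1))⁻¹) := by
  simp only [monoCopies]
  rw [colorAvg_const_mul, colorAvg_sum, Finset.sum_mul]
  congr 1
  refine Finset.sum_congr rfl fun s _ => ?_
  rw [colorAvg_const_mul]
  congr 1
  have hne : ((Finset.univ : Finset (Fin h)).map s).Nonempty := by
    rw [Finset.map_nonempty]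
    exact ⟨⟨0, hh⟩, Finset.mem_univ _⟩
  have h1 := colorAvg_monoInd (c := c) hc hne
  rw [Finset.card_map, Finset.card_univ, Fintype.card_fin] at h1
  rw [← h1]
  congr 1
  funext x
  simp [monoInd, IsMono]

lemma monoCopies_nonneg (H : SimpleGraph (Fin h)) (G : SimpleGraph (Fin N)) (x : Fin N → Fin c) :
    0 ≤ monoCopies H G x := by
  refine mul_nonneg (by positivity) (Finset.sum_nonneg fun s _ => mul_nonneg ?_ ?_)
  · rw [prod_adj_eq_ite]
    split_ifs <;> norm_num
  · split_ifs <;> norm_num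

lemma sum_prod_adj_le (H : SimpleGraph (Fin h)) (G : SimpleGraph (Fin N)) :
    ∑ s : Fin h ↪ Fin N, ∏ p ∈ edgePairs H, G.adjMatrix ℝ (s p.1) (s p.2) ≤ (N : ℝ) ^ h := by
  calc _ ≤ ∑ _s : Fin h ↪ Fin N, (1 : ℝ) := by
        refine Finset.sum_le_sum fun s _ => ?_
        rw [prod_adj_eq_ite]
        split_ifs <;> norm_num
    _ ≤ _ := by
        simp only [Finset.sum_const, Finset.card_univ, Fintype.card_embedding_eq, Fintype.card_fin,
          nsmul_eq_mul, mul_one]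
        exact_mod_cast Nat.descFactorial_le_pow N h

/-- The graph enters the exponent only through the numbers of embeddings that induce each labelled
`F`, which are the quantities with known limits. Each vertex set is the image of `h.factorial`
embeddings. -/
lemma poissonExponent_copyWeight (H : SimpleGraph (Fin h)) (G : SimpleGraph (Fin N)) (t : ℝ) :
    poissonExponent c h (copyWeight H G) t
      = ∑ F : SimpleGraph (Fin h), (((h.factorial : ℝ)⁻¹ * (((c : ℝ) ^ (h - 1))⁻¹ *
          ∑ s : Fin h ↪ Fin N, if G.comap s = F then (1 : ℝ) else 0) : ℝ) : ℂ) *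
        (Complex.exp ((t * F.copyCount H : ℝ) * Complex.I) - 1) := by
  rw [poissonExponent, sum_powersetCard_eq_sum_embedding (N := N) (h := h)
    (fun S => (((c : ℝ) ^ (h - 1))⁻¹ : ℝ) *
      (Complex.exp ((t * copyWeight H G S : ℝ) * Complex.I) - 1))]
  simp only [copyWeight_map]
  have h1 : ∀ s : Fin h ↪ Fin N,
      ((((c : ℝ) ^ (h - 1))⁻¹ : ℝ) : ℂ) *
        (Complex.exp ((t * (G.comap s).copyCount H : ℝ) * Complex.I) - 1)
      = ∑ F : SimpleGraph (Fin h), (((((c : ℝ) ^ (h - 1))⁻¹ : ℝ) : ℂ) *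
        ((if G.comap s = F then (1 : ℝ) else 0 : ℝ) : ℂ)) *
        (Complex.exp ((t * F.copyCount H : ℝ) * Complex.I) - 1) := by
    intro s
    rw [Finset.sum_eq_single_of_mem (G.comap s) (Finset.mem_univ _)]
    · simp
    · intro F _ hF
      rw [if_neg hF.symm]
      simp
  rw [Finset.sum_congr rfl fun s _ => h1 s, Finset.sum_comm, Finset.mul_sum]
  refine Finset.sum_congr rfl fun F _ => ?_
  rw [← Finset.sum_mul, ← Finset.mul_sum]
  push_cast
  ring

end Mean

/-! ### Asymptotics of the number of vertices and of the exponent -/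

section Asymptotics

variable {h : ℕ} {H : SimpleGraph (Fin h)} {N c : ℕ → ℕ} {G : (n : ℕ) → SimpleGraph (Fin (N n))}
  {lam : ℝ}

/-- The mean is at most $N^h/c^{h-1}$, and $c\le c^{h-1}$ for $h\ge2$; a mean above $\lambda/2$ thus
forces $N^h>\lambda c/2\to\infty$. -/
lemma tendsto_card_atTop (hh : 2 ≤ h) (hc : Tendsto c atTop atTop) (hlam : 0 < lam)
    (hT : Tendsto (fun n => colorAvg fun x : Fin (N n) → Fin (c n) => monoCopies H (G n) x) atTop
      (𝓝 lam)) : Tendsto N atTop atTop := by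
  have hcR : Tendsto (fun n => lam / 2 * (c n : ℝ)) atTop atTop :=
    (tendsto_natCast_atTop_atTop.comp hc).const_mul_atTop (by positivity)
  refine tendsto_atTop.2 fun b => ?_
  filter_upwards [hcR.eventually_gt_atTop ((b : ℝ) ^ h), hc.eventually_gt_atTop 0,
    hT.eventually_const_lt (half_lt_self hlam)] with n h1 h2 h3
  rw [colorAvg_monoCopies h2 (by omega)] at h3
  have hcpos : (0 : ℝ) < (c n : ℝ) ^ (h - 1) := by positivity
  have haut : (1 / (autCard H : ℝ)) ≤ 1 := by
    rw [div_le_one (by exact_mod_cast autCard_pos H)]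
    exact_mod_cast autCard_pos H
  have h4 : lam / 2 < (N n : ℝ) ^ h * ((c n : ℝ) ^ (h - 1))⁻¹ := by
    refine h3.trans_le ?_
    have h5 := mul_le_mul_of_nonneg_right (sum_prod_adj_le H (G n)) (inv_nonneg.2 hcpos.le)
    have h6 : (0 : ℝ) ≤ (N n : ℝ) ^ h * ((c n : ℝ) ^ (h - 1))⁻¹ := by positivity
    calc _ ≤ (1 / (autCard H : ℝ)) * ((N n : ℝ) ^ h * ((c n : ℝ) ^ (h - 1))⁻¹) :=
          mul_le_mul_of_nonneg_left h5 (by positivity)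
      _ ≤ 1 * ((N n : ℝ) ^ h * ((c n : ℝ) ^ (h - 1))⁻¹) := mul_le_mul_of_nonneg_right haut h6
      _ = _ := one_mul _
  rw [← div_eq_mul_inv, lt_div_iff₀ hcpos] at h4
  have h7 : (c n : ℝ) ≤ (c n : ℝ) ^ (h - 1) :=
    le_self_pow₀ (by exact_mod_cast h2) (by omega)
  have h8 : (b : ℝ) ^ h < (N n : ℝ) ^ h := by nlinarith
  have h9 := lt_of_pow_lt_pow_left₀ h (by positivity) h8
  exact_mod_cast h9.le

/-- The mean is $|Aut(H)|^{-1}(N^h/c^{h-1})$ times the injective density of $H$ in $G_n$; that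
density has the positive limit $t(H,W)$, so one may divide by it. -/
lemma ConvergesToGraphon.tendsto_pow_div {W : Graphon} (hG : ConvergesToGraphon G W) (hh : 2 ≤ h)
    (hW : 0 < W.homDensity H) (hc : Tendsto c atTop atTop) (hN : Tendsto N atTop atTop)
    (hT : Tendsto (fun n => colorAvg fun x : Fin (N n) → Fin (c n) => monoCopies H (G n) x) atTop
      (𝓝 lam)) :
    Tendsto (fun n => (N n : ℝ) ^ h / (c n : ℝ) ^ (h - 1)) atTop
      (𝓝 (lam * autCard H / W.homDensity H)) := by
  have hE := hG.tendsto_embedding hN H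
  refine ((hT.mul_const _).div hE hW.ne').congr' ?_
  filter_upwards [hE.eventually_const_lt hW, hN.eventually_gt_atTop 0, hc.eventually_gt_atTop 0]
    with n h1 h2 h3
  have hNpos : (0 : ℝ) < (N n : ℝ) ^ h := by positivity
  have haut : (autCard H : ℝ) ≠ 0 := by exact_mod_cast (autCard_pos H).ne'
  rw [Pi.div_apply, colorAvg_monoCopies h3 (by omega)]
  set E := ∑ s : Fin h ↪ Fin (N n), ∏ p ∈ edgePairs H, (G n).adjMatrix ℝ (s p.1) (s p.2)
  have hEne : E ≠ 0 := by
    rintro h0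
    rw [h0, zero_div] at h1
    exact h1.false
  field_simp

/-- $(N/c)^h=(N^h/c^{h-1})\cdot c^{-1}\to0$; then take the $h$-th root. -/
lemma tendsto_div_zero (hh : 2 ≤ h) (hc : Tendsto c atTop atTop) {κ : ℝ}
    (hκ : Tendsto (fun n => (N n : ℝ) ^ h / (c n : ℝ) ^ (h - 1)) atTop (𝓝 κ)) :
    Tendsto (fun n => (N n : ℝ) / c n) atTop (𝓝 0) := by
  have h1 : Tendsto (fun n => ((N n : ℝ) / c n) ^ h) atTop (𝓝 0) := by
    have h2 := hκ.mul (tendsto_inv_atTop_zero.comp (tendsto_natCast_atTop_atTop (R := ℝ).comp hc))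
    rw [mul_zero] at h2
    refine h2.congr fun n => ?_
    obtain ⟨m, rfl⟩ : ∃ m, h = m + 1 := ⟨h - 1, by omega⟩
    simp only [Function.comp, Nat.add_sub_cancel, div_pow]
    rw [pow_succ (c n : ℝ) m, ← div_eq_mul_inv, div_div]
  have h3 := h1.rpow_const (p := ((h : ℝ)⁻¹)) (Or.inr (by positivity))
  rw [Real.zero_rpow (by positivity)] at h3
  refine h3.congr fun n => ?_
  exact Real.pow_rpow_inv_natCast (by positivity) (by omega)

/-- The limit of the exponents, as a sum over isomorphism classes. -/
lemma ConvergesToGraphon.tendsto_poissonExponent {W : Graphon} (hG : ConvergesToGraphon G W)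
    (hN : Tendsto N atTop atTop) {κ : ℝ}
    (hκ : Tendsto (fun n => (N n : ℝ) ^ h / (c n : ℝ) ^ (h - 1)) atTop (𝓝 κ))
    {R : Finset (SimpleGraph (Fin h))} (hR : IsSupergraphList H R) (t : ℝ) :
    Tendsto (fun n => poissonExponent (c n) h (copyWeight H (G n)) t) atTop
      (𝓝 (∑ F ∈ R, ((κ * W.indDensity F / autCard F : ℝ) : ℂ) *
        (Complex.exp ((t * F.copyCount H : ℝ) * Complex.I) - 1))) := by
  -- The limit over labelled graphs. Passing to isomorphism classes multiplies by the orbit size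
  -- $h!/|Aut(F)|$, which cancels the $1/h!$; graphs without a copy of `H` contribute $e^0-1=0$.
  let g : SimpleGraph (Fin h) → ℂ := fun F => (((h.factorial : ℝ)⁻¹ * (κ * W.indDensity F) : ℝ) : ℂ)
    * (Complex.exp ((t * F.copyCount H : ℝ) * Complex.I) - 1)
  have hg : ∑ F, g F = ∑ F ∈ R, ((κ * W.indDensity F / autCard F : ℝ) : ℂ) *
        (Complex.exp ((t * F.copyCount H : ℝ) * Complex.I) - 1) := by
    rw [hR.sum_eq g]
    · refine Finset.sum_congr rfl fun F _ => ?_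
      have h1 : (h.factorial : ℂ) ≠ 0 := by exact_mod_cast h.factorial_ne_zero
      have h2 : (autCard F : ℂ) ≠ 0 := by exact_mod_cast (autCard_pos F).ne'
      simp only [g]
      push_cast
      field_simp
    · rintro F F' ⟨e⟩
      simp only [g, hG.indDensity_congr e, copyCount_congr H e]
    · intro F hF
      have : F.copyCount H = 0 := SimpleGraph.copyCount_eq_zero.2 hF
      simp [g, this]
  rw [← hg]
  simp only [poissonExponent_copyWeight]
  refine tendsto_finsetSum _ fun F _ => Tendsto.mul_const _ ?_
  refine (Complex.continuous_ofReal.tendsto _).comp (Tendsto.const_mul _ ?_)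
  refine (hκ.mul (hG.tendsto_comap hN F)).congr' ?_
  filter_upwards [hN.eventually_gt_atTop 0] with n hn
  have hNpos : (0 : ℝ) < (N n : ℝ) ^ h := by positivity
  field_simp

end Asymptotics

/-! ### Characteristic functions -/

lemma IsUniformColoring.charFun_monoCopies {Ω : Type*} [MeasurableSpace Ω] {μ : Measure Ω}
    [IsProbabilityMeasure μ] {h N c : ℕ} {X : Fin N → Ω → Fin c} (hX : IsUniformColoring μ X)
    (H : SimpleGraph (Fin h)) (G : SimpleGraph (Fin N)) (t : ℝ) :
    charFun (μ.map fun ω => monoCopies H G fun v => X v ω) t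
      = monoChar c h (copyWeight H G) t := by
  have hm : Measurable fun ω => monoCopies H G fun v => X v ω :=
    (Measurable.of_discrete (f := fun x : Fin N → Fin c => monoCopies H G x)).comp
      (measurable_pi_lambda _ hX.measurable)
  rw [charFun_apply_real, integral_map hm.aemeasurable (by fun_prop), monoChar,
    ← hX.integral_eq]
  simp only [monoCopies_eq_monoWeight]
  push_cast
  rfl

/-- From $|e^{iu}-1|\le|u|$ and $T\ge0$. It settles the case of vanishing mean. -/
lemma norm_monoChar_copyWeight_sub_one_le {h N c : ℕ} (hc : 0 < c) (H : SimpleGraph (Fin h))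
    (G : SimpleGraph (Fin N)) (t : ℝ) :
    ‖monoChar c h (copyWeight H G) t - 1‖
      ≤ |t| * colorAvg fun x : Fin N → Fin c => monoCopies H G x := by
  rw [monoChar, ← colorAvg_const (V := Fin N) hc (1 : ℂ), ← colorAvg_sub, ← colorAvg_const_mul]
  refine norm_colorAvg_le fun x => ?_
  rw [← monoCopies_eq_monoWeight, mul_comm _ Complex.I]
  refine (Real.norm_exp_I_mul_ofReal_sub_one_le).trans ?_
  rw [Real.norm_eq_abs, abs_mul, abs_of_nonneg (monoCopies_nonneg H G x)]

/-- The characteristic function of a linear combination of independent Poisson variables. -/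
lemma charFun_sum_mul_poisson {ι Ω : Type*} [Fintype ι] [MeasurableSpace Ω] {P : Measure Ω}
    [IsProbabilityMeasure P] {Y : ι → Ω → ℕ} {r : ι → NNReal}
    (hY : ∀ i, HasLaw (Y i) (poissonMeasure (r i)) P) (hind : iIndepFun Y P) (a : ι → ℝ) (t : ℝ) :
    charFun (P.map fun ω => ∑ i, a i * (Y i ω : ℝ)) t
      = Complex.exp (∑ i, (r i : ℂ) * (Complex.exp ((t * a i : ℝ) * Complex.I) - 1)) := by
  have hind' : iIndepFun (fun i ω => a i * (Y i ω : ℝ)) P :=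
    hind.comp (fun i m => a i * (m : ℝ)) fun i => .of_discrete
  have hmeas : ∀ i, AEMeasurable (fun ω => (Y i ω : ℝ)) P := fun i =>
    (Measurable.of_discrete (f := fun m : ℕ => (m : ℝ))).comp_aemeasurable (hY i).aemeasurable
  rw [hind'.charFun_map_fun_sum_eq_prod fun i => (hmeas i).const_mul _, Finset.prod_apply,
    Complex.exp_sum]
  refine Finset.prod_congr rfl fun i _ => ?_
  have hmap : P.map (fun ω => (Y i ω : ℝ)) = (poissonMeasure (r i)).map (fun m : ℕ => (m : ℝ)) := by
    rw [← (hY i).map_eq, AEMeasurable.map_map_of_aemeasurable (by fun_prop) (hY i).aemeasurable]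
    rfl
  have hmul : P.map (fun ω => a i * (Y i ω : ℝ))
      = (P.map (fun ω => (Y i ω : ℝ))).map (a i * ·) := by
    rw [AEMeasurable.map_map_of_aemeasurable (by fun_prop) (hmeas i)]
    rfl
  rw [hmul, charFun_map_mul, hmap]
  have := charFun_map_cast_poissonMeasure (r i) (a i * t)
  rw [mul_comm t]
  push_cast at this ⊢
  exact this

end

/-! ### Convergence in distribution -/

theorem theorem1p1
    {h : ℕ} (hh : 2 ≤ h) (H : SimpleGraph (Fin h)) (hH : H.Connected)
    (W : Graphon) (hW : 0 < W.homDensity H)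
    {N : ℕ → ℕ} (G : (n : ℕ) → SimpleGraph (Fin (N n))) (hG : ConvergesToGraphon G W)
    (c : ℕ → ℕ) (hc : Tendsto c atTop atTop)
    {Ω : ℕ → Type*} [∀ n, MeasurableSpace (Ω n)]
    (μ : (n : ℕ) → Measure (Ω n)) [∀ n, IsProbabilityMeasure (μ n)]
    (X : (n : ℕ) → Fin (N n) → Ω n → Fin (c n))
    (hX : ∀ n, IsUniformColoring (μ n) (X n))
    (lam : ℝ)
    (hlam : Tendsto (fun n => ∫ ω, monoCopies H (G n) (fun v => X n v ω) ∂(μ n)) atTop (𝓝 lam))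
    (R : Finset (SimpleGraph (Fin h))) (hR : IsSupergraphList H R)
    {Ω' : Type*} [MeasurableSpace Ω'] (P : Measure Ω') [IsProbabilityMeasure P]
    (Y : R → Ω' → ℕ)
    (hY : ∀ F : R, HasLaw (Y F) (poissonMeasure (Real.toNNReal
      (lam * ((autCard H : ℝ) / (autCard F.1 : ℝ)) * (W.indDensity F.1 / W.homDensity H)))) P)
    (hYindep : iIndepFun Y P) :
    TendstoInDistribution
      (fun n ω => monoCopies H (G n) (fun v => X n v ω)) atTop
      (fun ω => ∑ F : R, (F.1.copyCount H : ℝ) * (Y F ω : ℝ)) μ P := by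
  have hm : ∀ n, Measurable fun ω => monoCopies H (G n) fun v => X n v ω := fun n =>
    (Measurable.of_discrete (f := fun x : Fin (N n) → Fin (c n) => monoCopies H (G n) x)).comp
      (measurable_pi_lambda _ (hX n).measurable)
  have hlimm : AEMeasurable (fun ω => ∑ F : R, (F.1.copyCount H : ℝ) * (Y F ω : ℝ)) P :=
    Finset.aemeasurable_fun_sum _ fun F _ =>
      ((Measurable.of_discrete (f := fun m : ℕ => (m : ℝ))).comp_aemeasurable
        (hY F).aemeasurable).const_mul _
  have hT : Tendsto (fun n => colorAvg fun x : Fin (N n) → Fin (c n) => monoCopies H (G n) x)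
      atTop (𝓝 lam) := hlam.congr fun n => (hX n).integral_eq fun x => monoCopies H (G n) x
  have hcpos : ∀ᶠ n in atTop, 0 < c n := hc.eventually_gt_atTop 0
  have hlam0 : 0 ≤ lam := ge_of_tendsto' hlam fun n =>
    integral_nonneg fun ω => monoCopies_nonneg H (G n) _
  refine ⟨fun n => (hm n).aemeasurable, hlimm, ?_⟩
  refine ProbabilityMeasure.tendsto_iff_tendsto_charFun.2 fun t => ?_
  simp only [ProbabilityMeasure.coe_mk]
  rw [charFun_sum_mul_poisson hY hYindep]
  simp only [fun n => (hX n).charFun_monoCopies H (G n) t]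
  -- The rates are nonnegative, so `Real.toNNReal` truncates nothing; they are rewritten as
  -- $\kappa\,t_{\mathrm{ind}}(F,W)/|Aut(F)|$.
  have hrate : ∀ F : R, ((Real.toNNReal (lam * ((autCard H : ℝ) / (autCard F.1 : ℝ)) *
      (W.indDensity F.1 / W.homDensity H)) : ℝ) : ℂ)
      = ((lam * autCard H / W.homDensity H * W.indDensity F.1 / autCard F.1 : ℝ) : ℂ) := by
    intro F
    have := W.indDensity_nonneg F.1
    rw [Real.coe_toNNReal _ (by positivity)]
    congr 1
    ring
  rw [Finset.sum_congr rfl fun F _ => congrArg (· * _) (hrate F)]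
  -- If $\lambda=0$, then $N$ need not tend to infinity and the asymptotics above are unavailable,
  -- but all rates vanish and the target characteristic function is 1.
  rcases hlam0.eq_or_lt with rfl | hpos
  · simp only [zero_mul, zero_div, Complex.ofReal_zero, Finset.sum_const_zero, Complex.exp_zero]
    refine tendsto_iff_norm_sub_tendsto_zero.2 ?_
    have h1 := hT.const_mul |t|
    rw [mul_zero] at h1
    refine squeeze_zero' (Eventually.of_forall fun n => norm_nonneg _) ?_ h1
    filter_upwards [hcpos] with n hn
    exact norm_monoChar_copyWeight_sub_one_le hn H (G n) t
  · have hN := tendsto_card_atTop hh hc hpos hT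
    have hκ := hG.tendsto_pow_div hh hW hc hN hT
    have h1 := tendsto_monoChar_sub_exp hh hcpos hκ (tendsto_div_zero hh hc hκ)
      (w := fun n => copyWeight H (G n)) (fun n S hS => abs_copyWeight_le H (G n) hS) t
    have h2 := (Complex.continuous_exp.tendsto _).comp (hG.tendsto_poissonExponent hN hκ hR t)
    have h3 := h1.add h2
    simp only [Function.comp_def, sub_add_cancel, zero_add] at h3
    rw [← Finset.sum_coe_sort] at h3
    exact h3
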